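/- An $n$-qubit state is a unit vector of $\mathbb{C}^{2^n}$, with the basis of classical states $|x\rangle$, $x\in\{0,1\}^n$. It is called $s$-sparse if it is a linear combination of $s$ different classical states $|x\rangle$ (so $1\le s\le 2^n$). Consider circuits over the gates $X$, $P(\alpha)=\mathrm{diag}(1,e^{i\alpha})$, $CX$, $CR_Y(\theta)=\mathrm{diag}(I,R_Y(\theta))$ with $R_Y(\theta)=\begin{pmatrix}\cos\frac\theta2&-\sin\frac\theta2\\ \sin\frac\theta2&\cos\frac\theta2\end{pmatrix}$, and $CCX$ ($\alpha,\theta\in\mathbb{R}$), each applicable to any distinct qubits. The size of a circuit is its number of gates, its depth is its number of layers, where the gates of one layer act on pairwise disjoint sets of qubits, and its non-Clifford gates are all its gates $P(\alpha)$, $CR_Y(\theta)$ and $CCX$. **Theorem.** There is an absolute constant $K$ such that for all $s,n\in\mathbb{N}$ and every $s$-sparse $n$-qubit state $|\psi\rangle$, with $m:=\max\{s,n\}$, there is a circuit on $m$ qubits, i.e. with $m-n$ ancillas besides the $n$ qubits of $|\psi\rangle$, that maps $|0\rangle^{\otimes m}$ exactly to $|\psi\rangle\otimes|0\rangle^{\otimes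 (m-n)}$ and has size at most $K\,s\,m$, depth at most $K\,m$, and at most $K\,s$ non-Clifford gates. -/

import Mathlib

noncomputable section

namespace SparsePrep

/-- The state space `ℂ^(2^n)` of `n` qubits, with its `ℓ²` norm. Coordinates are indexed by bit
strings of length `n`. -/
abbrev Qubits (n : ℕ) : Type := EuclideanSpace ℂ (Fin n → Fin 2)

/-- Operators on `n` qubits, as matrices in the basis of classical states. -/
abbrev Op (n : ℕ) : Type := Matrix (Fin n → Fin 2) (Fin n → Fin 2) ℂ

/-- The classical state `|x⟩`. -/
def ket {n : ℕ} (x : Fin n → Fin 2) : Qubits n := EuclideanSpace.single x 1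

/-- The state `|0…0⟩`. -/
def ketZero (n : ℕ) : Qubits n := ket 0

/-- The tensor product `ψ ⊗ φ`: the first `n` qubits carry `ψ`, the last `a` carry `φ`. -/
def tensor {n a : ℕ} (ψ : Qubits n) (φ : Qubits a) : Qubits (n + a) :=
  WithLp.toLp 2 fun x => ψ (fun i => x (Fin.castAdd a i)) * φ (fun j => x (Fin.natAdd n j))

/-- An `s`-sparse `n`-qubit state: a normalized linear combination of `s` different classical
states. -/
def IsSparse {n : ℕ} (s : ℕ) (ψ : Qubits n) : Prop :=
  ‖ψ‖ = 1 ∧ ∃ (S : Finset (Fin n → Fin 2)) (α : (Fin n → Fin 2) → ℂ),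
    S.card = s ∧ ψ = ∑ x ∈ S, α x • ket x

/-- A `2 × 2` matrix seen as an operator on one qubit. -/
def oneQubit (A : Matrix (Fin 2) (Fin 2) ℂ) : Op 1 := Matrix.of fun x y => A (x 0) (y 0)

/-- The controlled version `diag(I, U)` of `U`; the control is the first qubit. -/
def controlled {k : ℕ} (U : Op k) : Op (k + 1) := Matrix.of fun x y =>
  if x 0 = 1 ∧ y 0 = 1 then U (Fin.tail x) (Fin.tail y) else if x = y then 1 else 0

/-- The NOT matrix. -/
def xMat : Matrix (Fin 2) (Fin 2) ℂ := !![0, 1; 1, 0]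

/-- The phase matrix `diag(1, e^{iα})`. -/
def pMat (α : ℝ) : Matrix (Fin 2) (Fin 2) ℂ := !![1, 0; 0, Complex.exp (α * Complex.I)]

/-- The rotation matrix `R_Y(θ)`. -/
def ryMat (θ : ℝ) : Matrix (Fin 2) (Fin 2) ℂ :=
  !![(Real.cos (θ / 2) : ℂ), -(Real.sin (θ / 2) : ℂ);
     (Real.sin (θ / 2) : ℂ), (Real.cos (θ / 2) : ℂ)]

/-- The gate set; a term of `Gate k` is a gate that acts on `k` qubits. -/
inductive Gate : ℕ → Type
  | X : Gate 1
  | P (α : ℝ) : Gate 1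
  | CX : Gate 2
  | CRY (θ : ℝ) : Gate 2
  | CCX : Gate 3

namespace Gate

/-- The matrix of a gate; controls come first, the target last. -/
def op : {k : ℕ} → Gate k → Op k
  | _, X => oneQubit xMat
  | _, P α => oneQubit (pMat α)
  | _, CX => controlled (oneQubit xMat)
  | _, CRY θ => controlled (oneQubit (ryMat θ))
  | _, CCX => controlled (controlled (oneQubit xMat))

/-- The gates counted as non-Clifford: every phase gate, every controlled rotation (whatever the
angle) and every doubly controlled NOT. The other two gates, `X` and `CX`, are Clifford. -/
def nonClifford : {k : ℕ} → Gate k → Bool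
  | _, X => false
  | _, P _ => true
  | _, CX => false
  | _, CRY _ => true
  | _, CCX => true

end Gate

/-- A gate together with the (distinct) qubits, among `m`, on which it acts, in order. -/
structure PlacedGate (m : ℕ) where
  arity : ℕ
  gate : Gate arity
  wires : Fin arity ↪ Fin m

/-- The operator on `m` qubits that acts as `U` on the qubits `w 0, w 1, …` and as the identity on
all other qubits. -/
def onWires {k m : ℕ} (w : Fin k ↪ Fin m) (U : Op k) : Op m := Matrix.of fun x y =>
  open Classical in
  if ∀ i, i ∉ Set.range w → x i = y i then U (fun j => x (w j)) (fun j => y (w j)) else 0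

/-- The operator of a placed gate. -/
def PlacedGate.op {m : ℕ} (g : PlacedGate m) : Op m := onWires g.wires g.gate.op

/-- Two placed gates can be run in parallel if they share no qubit. -/
def PlacedGate.Parallel {m : ℕ} (g h : PlacedGate m) : Prop :=
  Disjoint (Set.range g.wires) (Set.range h.wires)

/-- A circuit on `m` qubits: a sequence of layers, each a collection of gates that act on pairwise
disjoint sets of qubits. The first layer is applied first. -/
structure Circuit (m : ℕ) where
  layers : List (List (PlacedGate m))
  parallel : ∀ L ∈ layers, L.Pairwise PlacedGate.Parallel

namespace Circuit

variable {m : ℕ}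

/-- All gates of the circuit, in the order of application. -/
def gates (C : Circuit m) : List (PlacedGate m) := C.layers.flatten

/-- The number of gates. -/
def size (C : Circuit m) : ℕ := C.gates.length

/-- The number of layers. -/
def depth (C : Circuit m) : ℕ := C.layers.length

/-- The number of non-Clifford gates. -/
def nonCliffordCount (C : Circuit m) : ℕ := C.gates.countP fun g => g.gate.nonClifford

/-- The state that the circuit produces from the input state `ψ`. -/
def run (C : Circuit m) (ψ : Qubits m) : Qubits m :=
  C.gates.foldl (fun φ g => Matrix.toEuclideanLin g.op φ) ψ

/-- The circuit, started with all `n + a` qubits in state `|0⟩`, ends in `ψ` on the first `n`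
qubits, with the `a` ancillas back in state `|0⟩`. -/
def Prepares {n a : ℕ} (C : Circuit (n + a)) (ψ : Qubits n) : Prop :=
  C.run (ketZero (n + a)) = tensor ψ (ketZero a)

end Circuit

end SparsePrep

end

/-!
A sparse state `∑ α_x |x⟩` is prepared in two stages. A ladder of controlled rotations
(`exists_ladder`) first produces the one-hot superposition `∑ α_x |e_{w x}⟩` on `s` wires; all
amplitudes are handled there. The rest is classical: a reversible circuit on exactly `m` wires has
to map `s` given one-hot strings onto the `s` given bit strings (`exists_oneHot_circuit_univ`).
After a translation one of these strings is `0`.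

The classical stage is a divide and conquer over the field with two elements
(`exists_oneHot_circuit`). A second moment computation yields a linear functional that cuts the set
`S ∋ 0` into `S₀` (value `0`) and `S₁` (value `1`), both of size at most `3/4 #S`
(`exists_balanced`). Choose `p ∈ S₁` and let `A₀`, `A₁` be the spans of `S₀` and `S₁ + p`. A basis
of `A₀ + A₁` adapted to `A₀ ∩ A₁`, together with `p`, is linearly independent, and a linear circuit
maps one-hot strings to its vectors. In the coordinates given by this circuit, `S₀` and `S₁ + p`
overlap only in the coordinates of `A₀ ∩ A₁`, and the functional is a flag bit. If the common
coordinates of `S₁` are stored on wires of their own, the two parts live on disjoint blocks of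
wires, where they are produced recursively and in parallel; afterwards one `CCX` gate per dimension
of `A₀ ∩ A₁` moves these coordinates to the shared wires (`hasCircuit_merge`). This uses `#S - 1`
wires and no ancilla. The number of `CCX` gates plus the rank of `S` stays below `#S`, so it is
linear; since the sizes of the parts shrink geometrically, the depth is linear and the size is
quadratic.

Both the recursion and the passage from the span of the given strings to `s - 1` wires need linear
circuits of linear depth (`exists_linear_circuit`). Gaussian elimination (`exists_echelon`) writes
a matrix of `r` independent columns as a product of two unitriangular ones, up to the order of the
wires. A unitriangular matrix is a sequence of fans of `CX` gates, and if each fan visits its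
targets in the order in which they become idle, consecutive fans overlap in time: the whole sequence
takes linear depth (`fan_stair`).

Depth is computed on plain gate lists, by executing every gate as early as possible (`finish`);
`exists_circuit_of_finish_le` cuts such a list into layers.
-/

noncomputable section

namespace SparsePrep

variable {m : ℕ}

/-! ### Gate lists and their layering -/

/-- The operator of a list of gates; the head of the list is applied first. -/
def runList (l : List (PlacedGate m)) : Qubits m →ₗ[ℂ] Qubits m :=
  l.foldl (fun A g => Matrix.toEuclideanLin g.op ∘ₗ A) LinearMap.id

lemma foldl_toEuclideanLin (l : List (PlacedGate m)) (A : Qubits m →ₗ[ℂ] Qubits m)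
    (ψ : Qubits m) :
    l.foldl (fun φ g => Matrix.toEuclideanLin g.op φ) (A ψ) =
      l.foldl (fun A g => Matrix.toEuclideanLin g.op ∘ₗ A) A ψ := by
  induction l generalizing A with
  | nil => rfl
  | cons g l ih => exact ih (Matrix.toEuclideanLin g.op ∘ₗ A)

lemma runList_eq_foldl (l : List (PlacedGate m)) (ψ : Qubits m) :
    runList l ψ = l.foldl (fun φ g => Matrix.toEuclideanLin g.op φ) ψ :=
  (foldl_toEuclideanLin l LinearMap.id ψ).symm

@[simp] lemma runList_nil (ψ : Qubits m) : runList [] ψ = ψ := rfl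

lemma runList_append (l₁ l₂ : List (PlacedGate m)) (ψ : Qubits m) :
    runList (l₁ ++ l₂) ψ = runList l₂ (runList l₁ ψ) := by
  simp [runList_eq_foldl]

@[simp] lemma runList_singleton (g : PlacedGate m) (ψ : Qubits m) :
    runList [g] ψ = Matrix.toEuclideanLin g.op ψ := by
  simp [runList_eq_foldl]

lemma runList_cons (g : PlacedGate m) (l : List (PlacedGate m)) (ψ : Qubits m) :
    runList (g :: l) ψ = runList l (Matrix.toEuclideanLin g.op ψ) := by
  simp [runList_eq_foldl]

lemma onWires_mul_onWires_apply {k k' : ℕ} (w : Fin k ↪ Fin m) (w' : Fin k' ↪ Fin m)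
    (U : Op k) (U' : Op k') (h : Disjoint (Set.range w) (Set.range w')) (x y : Fin m → Fin 2) :
    (onWires w U * onWires w' U') x y =
      open Classical in
      if ∀ i, i ∉ Set.range w → i ∉ Set.range w' → x i = y i then
        U (fun j => x (w j)) (fun j => y (w j)) * U' (fun j => x (w' j)) (fun j => y (w' j))
      else 0 := by
  classical
  have hd : ∀ i, i ∈ Set.range w → i ∉ Set.range w' := fun i hi hi' =>
    Set.disjoint_left.mp h hi hi'
  rw [Matrix.mul_apply]
  -- only the string that agrees with `y` on `w` and with `x` elsewhere contributes
  rw [Finset.sum_eq_single (fun i => if i ∈ Set.range w then y i else x i)]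
  · have h1 : ∀ i, i ∉ Set.range w → x i = (fun i => if i ∈ Set.range w then y i else x i) i := by
      intro i hi; simp only [if_neg hi]
    simp only [onWires, Matrix.of_apply]
    rw [if_pos h1]
    have h2 : (fun j => if w j ∈ Set.range w then y (w j) else x (w j)) = fun j => y (w j) := by
      funext j; rw [if_pos ⟨j, rfl⟩]
    have h3 : (fun j => if w' j ∈ Set.range w then y (w' j) else x (w' j)) =
        fun j => x (w' j) := by
      funext j
      rw [if_neg (fun hj => hd _ hj ⟨j, rfl⟩)]
    rw [h2, h3]
    by_cases hc : ∀ i, i ∉ Set.range w → i ∉ Set.range w' → x i = y i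
    · rw [if_pos hc, if_pos]
      intro i hi
      by_cases hw : i ∈ Set.range w
      · rw [if_pos hw]
      · rw [if_neg hw]; exact hc i hw hi
    · rw [if_neg hc, if_neg, mul_zero]
      intro hc'
      apply hc
      intro i hi hi'
      have := hc' i hi'
      rwa [if_neg hi] at this
  · intro z _ hz
    by_contra hne
    apply hz
    have hne1 := left_ne_zero_of_mul hne
    have hne2 := right_ne_zero_of_mul hne
    simp only [onWires, Matrix.of_apply, ne_eq, ite_eq_right_iff, not_forall] at hne1 hne2
    obtain ⟨h1, -⟩ := hne1
    obtain ⟨h2, -⟩ := hne2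
    funext i
    by_cases hi : i ∈ Set.range w
    · rw [if_pos hi]; exact h2 i (hd i hi)
    · rw [if_neg hi]; exact (h1 i hi).symm
  · intro hn; exact absurd (Finset.mem_univ _) hn

lemma PlacedGate.Parallel.op_comm {g h : PlacedGate m} (hp : g.Parallel h) :
    g.op * h.op = h.op * g.op := by
  ext x y
  rw [PlacedGate.op, PlacedGate.op, onWires_mul_onWires_apply _ _ _ _ hp,
    onWires_mul_onWires_apply _ _ _ _ hp.symm]
  classical
  by_cases hc : ∀ i, i ∉ Set.range g.wires → i ∉ Set.range h.wires → x i = y i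
  · rw [if_pos hc, if_pos (fun i hi hi' => hc i hi' hi), mul_comm]
  · rw [if_neg hc, if_neg (fun hc' => hc fun i hi hi' => hc' i hi' hi)]

lemma PlacedGate.Parallel.apply_comm {g h : PlacedGate m} (hp : g.Parallel h) (ψ : Qubits m) :
    Matrix.toEuclideanLin g.op (Matrix.toEuclideanLin h.op ψ) =
      Matrix.toEuclideanLin h.op (Matrix.toEuclideanLin g.op ψ) := by
  have h1 := Matrix.toLpLin_mul (R := ℂ) 2 2 2 g.op h.op
  have h2 := Matrix.toLpLin_mul (R := ℂ) 2 2 2 h.op g.op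
  rw [hp.op_comm] at h1
  exact LinearMap.congr_fun (h1.symm.trans h2) ψ

lemma runList_apply_comm (g : PlacedGate m) (l : List (PlacedGate m))
    (hl : ∀ h ∈ l, g.Parallel h) (ψ : Qubits m) :
    runList l (Matrix.toEuclideanLin g.op ψ) = Matrix.toEuclideanLin g.op (runList l ψ) := by
  induction l generalizing ψ with
  | nil => rfl
  | cons h l ih =>
    rw [runList_cons, runList_cons, ← (hl h (by simp)).apply_comm,
      ih (fun h' hh' => hl h' (by simp [hh']))]

/-- The set of qubits on which a placed gate acts. -/
def PlacedGate.wireSet (g : PlacedGate m) : Finset (Fin m) := Finset.univ.map g.wires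

lemma PlacedGate.coe_wireSet (g : PlacedGate m) :
    (g.wireSet : Set (Fin m)) = Set.range g.wires := by
  simp [PlacedGate.wireSet]

lemma PlacedGate.parallel_iff (g h : PlacedGate m) :
    g.Parallel h ↔ Disjoint g.wireSet h.wireSet := by
  rw [PlacedGate.Parallel, ← g.coe_wireSet, ← h.coe_wireSet, Finset.disjoint_coe]

lemma PlacedGate.wireSet_nonempty (g : PlacedGate m) : g.wireSet.Nonempty := by
  obtain ⟨k, gate, w⟩ := g
  cases gate <;> exact ⟨w 0, by simp [PlacedGate.wireSet]⟩

/-- The effect of a gate on the profile `d`, where `d w` is the number of layers after which the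
wire `w` is idle when every gate is executed as early as possible. -/
def PlacedGate.advance (g : PlacedGate m) (d : Fin m → ℕ) : Fin m → ℕ := fun w =>
  if w ∈ g.wireSet then g.wireSet.sup d + 1 else d w

/-- The profile reached from `d` by executing a list of gates, each as early as possible. -/
def finish (l : List (PlacedGate m)) (d : Fin m → ℕ) : Fin m → ℕ :=
  l.foldl (fun d g => g.advance d) d

@[simp] lemma finish_nil (d : Fin m → ℕ) : finish [] d = d := rfl

lemma finish_append (l₁ l₂ : List (PlacedGate m)) (d : Fin m → ℕ) :
    finish (l₁ ++ l₂) d = finish l₂ (finish l₁ d) := by simp [finish]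

lemma finish_cons (g : PlacedGate m) (l : List (PlacedGate m)) (d : Fin m → ℕ) :
    finish (g :: l) d = finish l (g.advance d) := rfl

lemma PlacedGate.le_advance (g : PlacedGate m) (d : Fin m → ℕ) (w : Fin m) :
    d w ≤ g.advance d w := by
  unfold PlacedGate.advance
  split_ifs with h
  · exact (Finset.le_sup (f := d) h).trans (Nat.le_succ _)
  · exact le_rfl

/-- A list of gates can be cut into `T` layers, for every bound `T` on the entries of its
earliest-execution profile. -/
theorem exists_circuit_of_finish_le (l : List (PlacedGate m)) (T : ℕ)
    (hT : ∀ w, finish l 0 w ≤ T) :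
    ∃ C : Circuit m, C.depth = T ∧ C.gates.Perm l ∧ ∀ ψ, C.run ψ = runList l ψ := by
  suffices h : ∃ C : Circuit m, C.depth = T ∧ C.gates.Perm l ∧ (∀ ψ, C.run ψ = runList l ψ) ∧
      ∀ (i : ℕ) (L), C.layers[i]? = some L → ∀ g ∈ L, ∀ w ∈ g.wireSet, i < finish l 0 w by
    obtain ⟨C, h1, h2, h3, -⟩ := h
    exact ⟨C, h1, h2, h3⟩
  induction l using List.reverseRecOn with
  | nil =>
    refine ⟨⟨List.replicate T [], ?_⟩, by simp [Circuit.depth], ?_, ?_, ?_⟩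
    · intro L hL
      rw [List.eq_of_mem_replicate hL]; exact List.Pairwise.nil
    · simp [Circuit.gates]
    · intro ψ; simp [Circuit.run, Circuit.gates]
    · intro i L h g hg
      rw [List.eq_of_mem_replicate (List.mem_of_getElem? h)] at hg
      simp at hg
  | append_singleton l g ih =>
    have hfin : finish (l ++ [g]) 0 = g.advance (finish l 0) := by
      rw [finish_append]; rfl
    rw [hfin] at hT ⊢
    obtain ⟨C, hd, hp, hr, hinv⟩ := ih fun w => (g.le_advance _ w).trans (hT w)
    set d := finish l 0 with hdd
    set t := g.wireSet.sup d with ht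
    have hadv : ∀ w ∈ g.wireSet, g.advance d w = t + 1 := fun w hw => by
      simp [PlacedGate.advance, hw, ht]
    have htT : t < C.layers.length := by
      obtain ⟨w, hw⟩ := g.wireSet_nonempty
      have := hT w
      rw [hadv w hw] at this
      have hd' : C.layers.length = T := hd
      omega
    -- the new gate goes into layer `t`, the first one from which on its wires are idle
    obtain ⟨A, L, B, hAB, hA⟩ : ∃ A L B, C.layers = A ++ L :: B ∧ A.length = t :=
      ⟨C.layers.take t, C.layers[t], C.layers.drop (t + 1), by
        rw [List.getElem_cons_drop, List.take_append_drop], by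
        rw [List.length_take]; omega⟩
    have hidle : ∀ i L', C.layers[i]? = some L' → t ≤ i → ∀ h ∈ L', g.Parallel h := by
      intro i L' h' hle h hh
      rw [PlacedGate.parallel_iff, Finset.disjoint_left]
      intro w hw hw'
      have h1 := hinv i L' h' h hh w hw'
      have h2 : d w ≤ t := Finset.le_sup hw
      omega
    have hL : ∀ h ∈ L, g.Parallel h :=
      hidle A.length L (by rw [hAB, List.getElem?_append_right le_rfl]; simp) hA.ge
    have hB : ∀ h ∈ B.flatten, g.Parallel h := by
      intro h hh
      obtain ⟨L', hL', hh'⟩ := List.mem_flatten.mp hh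
      obtain ⟨B₁, B₂, rfl⟩ := List.append_of_mem hL'
      refine hidle (A ++ L :: B₁).length L' ?_ (by simp; omega) h hh'
      have : C.layers = (A ++ L :: B₁) ++ L' :: B₂ := by simp [hAB]
      rw [this, List.getElem?_append_right le_rfl]; simp
    have hpar : ∀ L' ∈ A ++ (L ++ [g]) :: B, L'.Pairwise PlacedGate.Parallel := by
      intro L' hL'
      have hpar := C.parallel
      rw [hAB] at hpar
      simp only [List.mem_append, List.mem_cons] at hL' hpar
      rcases hL' with h | rfl | h
      · exact hpar _ (Or.inl h)
      · rw [List.pairwise_append]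
        refine ⟨hpar _ (Or.inr (Or.inl rfl)), by simp, ?_⟩
        intro a ha b hb
        rw [List.mem_singleton.mp hb]
        exact (hL a ha).symm
      · exact hpar _ (Or.inr (Or.inr h))
    refine ⟨⟨A ++ (L ++ [g]) :: B, hpar⟩, ?_, ?_, ?_, ?_⟩
    · rw [← hd]; simp [Circuit.depth, hAB]
    · have h1 : C.gates = A.flatten ++ (L ++ B.flatten) := by simp [Circuit.gates, hAB]
      have h2 : (Circuit.gates ⟨A ++ (L ++ [g]) :: B, hpar⟩) =
          A.flatten ++ (L ++ ([g] ++ B.flatten)) := by simp [Circuit.gates]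
      rw [h2]
      refine List.Perm.trans ?_ (hp.append_right [g])
      rw [h1, List.append_assoc, List.append_assoc]
      exact (List.perm_append_comm.append_left _).append_left _
    · intro ψ
      have h1 : C.run ψ = runList (A.flatten ++ L ++ B.flatten) ψ := by
        rw [runList_eq_foldl]; simp [Circuit.run, Circuit.gates, hAB]
      have h3 : (Circuit.run ⟨A ++ (L ++ [g]) :: B, hpar⟩ ψ) =
          runList (A.flatten ++ L ++ [g] ++ B.flatten) ψ := by
        rw [runList_eq_foldl]; simp [Circuit.run, Circuit.gates]
      rw [h3, runList_append _ B.flatten, runList_append _ [g], runList_append _ [g],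
        runList_singleton, runList_singleton, runList_apply_comm g _ hB, ← hr, h1,
        runList_append _ B.flatten]
    · intro i L' h' h hh w hw
      have hle := g.le_advance d w
      rcases lt_trichotomy i A.length with hi | rfl | hi
      · refine (hinv i L' ?_ h hh w hw).trans_le hle
        rw [hAB, List.getElem?_append_left hi]
        rwa [List.getElem?_append_left hi] at h'
      · rw [List.getElem?_append_right le_rfl] at h'
        simp only [Nat.sub_self, List.getElem?_cons_zero, Option.some.injEq] at h'
        rw [← h', List.mem_append] at hh
        rcases hh with hh | hh
        · refine (hinv A.length L ?_ h hh w hw).trans_le hle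
          rw [hAB, List.getElem?_append_right le_rfl]; simp
        · rw [List.mem_singleton.mp hh] at hw
          rw [hadv w hw, hA]; omega
      · refine (hinv i L' ?_ h hh w hw).trans_le hle
        rw [List.getElem?_append_right hi.le] at h'
        rw [hAB, List.getElem?_append_right hi.le, ← h']
        obtain ⟨j, hj⟩ : ∃ j, i - A.length = j + 1 := ⟨i - A.length - 1, by omega⟩
        rw [hj, List.getElem?_cons_succ, List.getElem?_cons_succ]

/-! ### The gates on classical states -/

/-- Bit strings of length `m`, as vectors over the field with two elements. -/
abbrev Bits (m : ℕ) : Type := Fin m → ZMod 2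

/-- The classical state of a bit string over `ZMod 2`, which is definitionally `Fin 2`. -/
def cket (x : Bits m) : Qubits m := ket (n := m) x

/-- The bit string whose only nonzero entry is at `w`. -/
abbrev unit (w : Fin m) : Bits m := Pi.single w 1

/-- If the column of `U` at the bits of `y` on the wires has at most two nonzero entries, then so
has the column of the placed operator at `y`. -/
lemma onWires_ket {k : ℕ} (w : Fin k ↪ Fin m) (U : Op k) (y y₁ y₂ : Fin m → Fin 2) (c₁ c₂ : ℂ)
    (h₁ : ∀ i, i ∉ Set.range w → y₁ i = y i) (h₂ : ∀ i, i ∉ Set.range w → y₂ i = y i)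
    (hU : ∀ v, U v (fun j => y (w j)) =
      (if v = fun j => y₁ (w j) then c₁ else 0) + if v = fun j => y₂ (w j) then c₂ else 0) :
    Matrix.toEuclideanLin (onWires w U) (ket y) = c₁ • ket y₁ + c₂ • ket y₂ := by
  classical
  ext x
  have hx : ∀ z : Fin m → Fin 2, (∀ i, i ∉ Set.range w → z i = y i) →
      ((x = z) ↔ (∀ i, i ∉ Set.range w → x i = y i) ∧
        (fun j => x (w j)) = fun j => z (w j)) := by
    intro z hz
    constructor
    · rintro rfl; exact ⟨hz, rfl⟩
    · rintro ⟨ha, hb⟩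
      funext i
      by_cases hi : i ∈ Set.range w
      · obtain ⟨j, rfl⟩ := hi; exact congrFun hb j
      · rw [ha i hi, hz i hi]
  have hl : Matrix.toEuclideanLin (onWires w U) (ket y) x = onWires w U x y := by
    simp [Matrix.toLpLin_apply, ket, EuclideanSpace.single]
  rw [hl]
  simp only [onWires, Matrix.of_apply, PiLp.add_apply, PiLp.smul_apply, ket,
    PiLp.single_apply, smul_eq_mul, mul_ite, mul_one, mul_zero, hU, hx y₁ h₁, hx y₂ h₂]
  by_cases hc : ∀ i, i ∉ Set.range w → x i = y i
  · simp only [if_pos hc, and_iff_right hc]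
  · simp only [hc, false_and, if_false, add_zero]

lemma onWires_ket_single {k : ℕ} (w : Fin k ↪ Fin m) (U : Op k) (y y₁ : Fin m → Fin 2) (c : ℂ)
    (h₁ : ∀ i, i ∉ Set.range w → y₁ i = y i)
    (hU : ∀ v, U v (fun j => y (w j)) = if v = fun j => y₁ (w j) then c else 0) :
    Matrix.toEuclideanLin (onWires w U) (ket y) = c • ket y₁ := by
  have := onWires_ket w U y y₁ y₁ c 0 h₁ h₁ (by simpa using hU)
  simpa using this

/-- One wire. -/
def wires₁ (a : Fin m) : Fin 1 ↪ Fin m := ⟨![a], fun i j _ => Subsingleton.elim i j⟩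

/-- Two distinct wires. -/
def wires₂ (a b : Fin m) (h : a ≠ b) : Fin 2 ↪ Fin m :=
  ⟨![a, b], by intro i j; fin_cases i <;> fin_cases j <;> simp [h, h.symm]⟩

/-- Three distinct wires. -/
def wires₃ (a b c : Fin m) (hab : a ≠ b) (hac : a ≠ c) (hbc : b ≠ c) : Fin 3 ↪ Fin m :=
  ⟨![a, b, c], by
    intro i j
    fin_cases i <;> fin_cases j <;> simp [hab, hab.symm, hac, hac.symm, hbc, hbc.symm]⟩

/-- The gate `X` on the wire `a`. -/
def gX (a : Fin m) : PlacedGate m := ⟨1, .X, wires₁ a⟩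

/-- The gate `P(α)` on the wire `a`. -/
def gP (α : ℝ) (a : Fin m) : PlacedGate m := ⟨1, .P α, wires₁ a⟩

/-- The gate `CX` with control `a` and target `b`. -/
def gCX (a b : Fin m) (h : a ≠ b) : PlacedGate m := ⟨2, .CX, wires₂ a b h⟩

/-- The gate `CR_Y(θ)` with control `a` and target `b`. -/
def gCRY (θ : ℝ) (a b : Fin m) (h : a ≠ b) : PlacedGate m := ⟨2, .CRY θ, wires₂ a b h⟩

/-- The gate `CCX` with controls `a`, `b` and target `c`. -/
def gCCX (a b c : Fin m) (hab : a ≠ b) (hac : a ≠ c) (hbc : b ≠ c) : PlacedGate m :=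
  ⟨3, .CCX, wires₃ a b c hab hac hbc⟩

@[simp] lemma wires₁_zero (a : Fin m) : wires₁ a 0 = a := rfl
@[simp] lemma wires₂_zero (a b : Fin m) (h : a ≠ b) : wires₂ a b h 0 = a := rfl
@[simp] lemma wires₂_one (a b : Fin m) (h : a ≠ b) : wires₂ a b h 1 = b := rfl

@[simp] lemma wireSet_gX (a : Fin m) : (gX a).wireSet = {a} := by
  ext i
  rw [← Finset.mem_coe, PlacedGate.coe_wireSet]
  change i ∈ Set.range (wires₁ a) ↔ _
  simp [eq_comm]

@[simp] lemma wireSet_gCX (a b : Fin m) (h : a ≠ b) : (gCX a b h).wireSet = {a, b} := by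
  ext i
  rw [← Finset.mem_coe, PlacedGate.coe_wireSet]
  change i ∈ Set.range (wires₂ a b h) ↔ _
  simp [eq_comm]

@[simp] lemma wireSet_gCCX (a b c : Fin m) (hab : a ≠ b) (hac : a ≠ c) (hbc : b ≠ c) :
    (gCCX a b c hab hac hbc).wireSet = {a, b, c} := by
  ext i
  rw [← Finset.mem_coe, PlacedGate.coe_wireSet]
  change i ∈ Set.range (wires₃ a b c hab hac hbc) ↔ _
  simp only [Set.mem_range, Finset.mem_singleton, Finset.mem_insert]
  rw [Fin.exists_fin_succ, Fin.exists_fin_two, @eq_comm _ i a, @eq_comm _ i b, @eq_comm _ i c]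
  rfl

lemma bit_cases (b : Fin 2) : b = 0 ∨ b = 1 := by fin_cases b <;> simp

lemma oneQubit_xMat_apply (v u z : Fin 1 → Fin 2) (h : z 0 = u 0 + 1) :
    oneQubit xMat v u = if v = z then 1 else 0 := by
  simp only [funext_iff, Fin.forall_fin_one, h]
  rcases bit_cases (v 0) with h1 | h1 <;> rcases bit_cases (u 0) with h2 | h2 <;>
    simp [oneQubit, xMat, h1, h2]

lemma oneQubit_pMat_apply (α : ℝ) (v u : Fin 1 → Fin 2) :
    oneQubit (pMat α) v u =
      if v = u then (if u 0 = 1 then Complex.exp (α * Complex.I) else 1) else 0 := by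
  simp only [funext_iff, Fin.forall_fin_one]
  rcases bit_cases (v 0) with h1 | h1 <;> rcases bit_cases (u 0) with h2 | h2 <;>
    simp [oneQubit, pMat, h1, h2]

lemma eq_iff_zero_and_tail {k : ℕ} (v z : Fin (k + 1) → Fin 2) :
    v = z ↔ v 0 = z 0 ∧ Fin.tail v = Fin.tail z := by
  rw [funext_iff, Fin.forall_fin_succ, funext_iff]; rfl

/-- A controlled permutation matrix is a permutation matrix. -/
lemma controlled_apply {k : ℕ} (U : Op k) (u z : Fin (k + 1) → Fin 2) (h0 : z 0 = u 0)
    (hz : u 0 = 0 → z = u)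
    (hU : u 0 = 1 → ∀ v, U v (Fin.tail u) = if v = Fin.tail z then 1 else 0)
    (v : Fin (k + 1) → Fin 2) :
    controlled U v u = if v = z then 1 else 0 := by
  rcases bit_cases (u 0) with h2 | h2
  · simp [controlled, h2, hz h2]
  · simp only [controlled, Matrix.of_apply, h2, and_true, hU h2]
    simp only [eq_iff_zero_and_tail v z, h0, h2]
    by_cases h1 : v 0 = 1
    · simp [h1]
    · have : v ≠ u := fun h => h1 (by rw [h, h2])
      simp [h1, this]

lemma controlled_ryMat_apply (θ : ℝ) (v u z : Fin 2 → Fin 2) (hu0 : u 0 = 1) (hu1 : u 1 = 0)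
    (hz0 : z 0 = 1) (hz1 : z 1 = 1) :
    controlled (oneQubit (ryMat θ)) v u =
      (if v = u then (Real.cos (θ / 2) : ℂ) else 0) +
        if v = z then (Real.sin (θ / 2) : ℂ) else 0 := by
  simp only [controlled, oneQubit, Matrix.of_apply, funext_iff, Fin.forall_fin_two, hu0, hu1, hz0,
    hz1, Fin.tail]
  rcases bit_cases (v 0) with h1 | h1 <;> rcases bit_cases (v 1) with h2 | h2 <;>
    simp [ryMat, h1, h2, hu0, hu1]

lemma add_single_apply_of_ne (x : Bits m) {a i : Fin m} (c : ZMod 2) (h : i ≠ a) :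
    (x + Pi.single a c : Bits m) i = x i := by simp [h]

lemma apply_gX (a : Fin m) (x : Bits m) :
    Matrix.toEuclideanLin (gX a).op (cket x) = cket (x + unit a) := by
  have := onWires_ket_single (wires₁ a) (oneQubit xMat) x (x + unit a : Bits m) 1
    (fun i hi => add_single_apply_of_ne x 1 (fun h => hi ⟨0, h.symm⟩))
    (fun v => oneQubit_xMat_apply v _ _ (by
      have h1 : (x + unit a : Bits m) a = x a + 1 := by simp
      exact h1))
  rw [one_smul] at this; exact this

lemma apply_gP (α : ℝ) (a : Fin m) (x : Bits m) :
    Matrix.toEuclideanLin (gP α a).op (cket x) =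
      (if x a = 1 then Complex.exp (α * Complex.I) else 1) • cket x :=
  onWires_ket_single (wires₁ a) (oneQubit (pMat α)) x x _ (fun _ _ => rfl)
    (fun v => oneQubit_pMat_apply α v _)

lemma apply_gCX (a b : Fin m) (h : a ≠ b) (x : Bits m) :
    Matrix.toEuclideanLin (gCX a b h).op (cket x) = cket (x + Pi.single b (x a)) := by
  have h1 : (x + Pi.single b (x a) : Bits m) b = x b + x a := by simp
  have h2 : (x + Pi.single b (x a) : Bits m) a = x a := by simp [h]
  have := onWires_ket_single (wires₂ a b h) (controlled (oneQubit xMat)) x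
    (x + Pi.single b (x a) : Bits m) 1
    (fun i hi => add_single_apply_of_ne x _ (fun h => hi ⟨1, h.symm⟩))
    (controlled_apply _ _ _ h2 ?_ ?_)
  · rw [one_smul] at this; exact this
  · intro h0
    have h0 : x a = 0 := h0
    rw [h0, Pi.single_zero, add_zero]
  · intro h0 v
    have h0 : x a = 1 := h0
    exact oneQubit_xMat_apply _ _ _ (h1.trans (by rw [h0]; rfl))

lemma apply_gCCX (a b c : Fin m) (hab : a ≠ b) (hac : a ≠ c) (hbc : b ≠ c) (x : Bits m) :
    Matrix.toEuclideanLin (gCCX a b c hab hac hbc).op (cket x) =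
      cket (x + Pi.single c (x a * x b)) := by
  have h1 : (x + Pi.single c (x a * x b) : Bits m) c = x c + x a * x b := by simp
  have h2 : (x + Pi.single c (x a * x b) : Bits m) a = x a := by simp [hac]
  have h3 : (x + Pi.single c (x a * x b) : Bits m) b = x b := by simp [hbc]
  have := onWires_ket_single (wires₃ a b c hab hac hbc) (controlled (controlled (oneQubit xMat))) x
    (x + Pi.single c (x a * x b) : Bits m) 1
    (fun i hi => add_single_apply_of_ne x _ (fun h => hi ⟨2, h.symm⟩))
    (controlled_apply _ _ _ h2 ?_ ?_)
  · rw [one_smul] at this; exact this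
  · intro h0
    have h0 : x a = 0 := h0
    rw [h0, zero_mul, Pi.single_zero, add_zero]
  · intro h0
    have h0 : x a = 1 := h0
    refine controlled_apply _ _ _ h3 ?_ ?_
    · intro h0'
      have h0' : x b = 0 := h0'
      rw [h0', mul_zero, Pi.single_zero, add_zero]
    · intro h0' v
      have h0' : x b = 1 := h0'
      exact oneQubit_xMat_apply _ _ _ (h1.trans (by rw [h0, h0']; rfl))

lemma apply_gCRY_of_eq_zero (θ : ℝ) (a b : Fin m) (h : a ≠ b) (x : Bits m) (hx : x a = 0) :
    Matrix.toEuclideanLin (gCRY θ a b h).op (cket x) = cket x := by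
  have := onWires_ket_single (wires₂ a b h) (controlled (oneQubit (ryMat θ))) x
    x 1 (fun _ _ => rfl)
    (controlled_apply _ _ _ rfl (fun _ => rfl) (fun h1 => by
      have h1 : x a = 1 := h1
      rw [hx] at h1; exact absurd h1 zero_ne_one))
  rw [one_smul] at this; exact this

lemma apply_gCRY_of_eq_one (θ : ℝ) (a b : Fin m) (h : a ≠ b) (x : Bits m) (hx : x a = 1)
    (hb : x b = 0) :
    Matrix.toEuclideanLin (gCRY θ a b h).op (cket x) =
      (Real.cos (θ / 2) : ℂ) • cket x + (Real.sin (θ / 2) : ℂ) • cket (x + unit b) := by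
  have h1 : (x + unit b : Bits m) b = 1 := by simp [hb]
  have h2 : (x + unit b : Bits m) a = 1 := by simp [h, hx]
  refine onWires_ket (wires₂ a b h) (controlled (oneQubit (ryMat θ))) x x (x + unit b : Bits m)
    _ _ (fun _ _ => rfl)
    (fun i hi => add_single_apply_of_ne x _ (fun h => hi ⟨1, h.symm⟩)) ?_
  exact fun v => controlled_ryMat_apply θ v _ _ hx hb h2 h1

/-! ### Reversible circuits with resource bounds -/

lemma PlacedGate.advance_of_notMem (g : PlacedGate m) (d : Fin m → ℕ) {w : Fin m}
    (h : w ∉ g.wireSet) : g.advance d w = d w := if_neg h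

lemma finish_of_notMem {l : List (PlacedGate m)} {W : Finset (Fin m)}
    (hl : ∀ g ∈ l, g.wireSet ⊆ W) (d : Fin m → ℕ) {w : Fin m} (hw : w ∉ W) :
    finish l d w = d w := by
  induction l generalizing d with
  | nil => rfl
  | cons g l ih =>
    rw [finish_cons, ih (fun h hh => hl h (by simp [hh])),
      g.advance_of_notMem _ (fun h => hw (hl g (by simp) h))]

/-- The list `l` of gates touches only the wires in `W` and maps each classical state `|x⟩` to
`|f x⟩`. The field `map_add` records that the action does not depend on bits outside `W`. -/
structure Implements (l : List (PlacedGate m)) (W : Finset (Fin m)) (f : Bits m → Bits m) :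
    Prop where
  supp : ∀ g ∈ l, g.wireSet ⊆ W
  run : ∀ x, runList l (cket x) = cket (f x)
  map_add : ∀ x y, (∀ w ∈ W, y w = 0) → f (x + y) = f x + y

/-- The list `l` of gates has at most `s` gates, at most `c` of them non-Clifford, and it delays
the wires in `W` by at most `d` layers. -/
structure Bounded (l : List (PlacedGate m)) (W : Finset (Fin m)) (s d c : ℕ) : Prop where
  length_le : l.length ≤ s
  finish_le : ∀ (e : Fin m → ℕ) (k : ℕ), (∀ w ∈ W, e w ≤ k) → ∀ w ∈ W, finish l e w ≤ k + d
  count_le : l.countP (fun g => g.gate.nonClifford) ≤ c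

/-- The map `f` on classical states is implemented on the wires in `W` by at most `s` gates, in
depth at most `d`, with at most `c` non-Clifford gates. -/
def HasCircuit (W : Finset (Fin m)) (f : Bits m → Bits m) (s d c : ℕ) : Prop :=
  ∃ l, Implements l W f ∧ Bounded l W s d c

lemma Implements.append {l l' : List (PlacedGate m)} {W : Finset (Fin m)} {f f' : Bits m → Bits m}
    (h : Implements l W f) (h' : Implements l' W f') :
    Implements (l ++ l') W (fun x => f' (f x)) where
  supp g hg := (List.mem_append.mp hg).elim (h.supp g) (h'.supp g)
  run x := by rw [runList_append, h.run, h'.run]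
  map_add x y hy := by rw [h.map_add x y hy, h'.map_add _ y hy]

lemma Implements.mono {l : List (PlacedGate m)} {W W' : Finset (Fin m)} {f : Bits m → Bits m}
    (h : Implements l W f) (hW : W ⊆ W') : Implements l W' f where
  supp g hg := (h.supp g hg).trans hW
  run := h.run
  map_add x y hy := h.map_add x y fun w hw => hy w (hW hw)

lemma Bounded.append {l l' : List (PlacedGate m)} {W : Finset (Fin m)} {s s' d d' c c' : ℕ}
    (h : Bounded l W s d c) (h' : Bounded l' W s' d' c') :
    Bounded (l ++ l') W (s + s') (d + d') (c + c') where
  length_le := by rw [List.length_append]; exact add_le_add h.length_le h'.length_le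
  finish_le e k he w hw := by
    rw [finish_append, ← add_assoc]
    exact h'.finish_le _ _ (h.finish_le e k he) w hw
  count_le := by rw [List.countP_append]; exact add_le_add h.count_le h'.count_le

lemma HasCircuit.comp {W : Finset (Fin m)} {f f' : Bits m → Bits m} {s s' d d' c c' : ℕ}
    (h : HasCircuit W f s d c) (h' : HasCircuit W f' s' d' c') :
    HasCircuit W (fun x => f' (f x)) (s + s') (d + d') (c + c') := by
  obtain ⟨l, h1, h2⟩ := h
  obtain ⟨l', h1', h2'⟩ := h'
  exact ⟨l ++ l', h1.append h1', h2.append h2'⟩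

lemma HasCircuit.mono {W W' : Finset (Fin m)} {f : Bits m → Bits m} {s s' d d' c c' : ℕ}
    (h : HasCircuit W f s d c) (hW : W ⊆ W') (hs : s ≤ s') (hd : d ≤ d') (hc : c ≤ c') :
    HasCircuit W' f s' d' c' := by
  obtain ⟨l, h1, h2⟩ := h
  refine ⟨l, h1.mono hW, h2.length_le.trans hs, fun e k he w hw => ?_, h2.count_le.trans hc⟩
  by_cases hw' : w ∈ W
  · exact (h2.finish_le e k (fun w hw => he w (hW hw)) w hw').trans (by omega)
  · rw [finish_of_notMem h1.supp e hw']
    exact (he w hw).trans (by omega)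

/-- Circuits on disjoint sets of wires run in parallel: their depths do not add up. -/
lemma HasCircuit.par {W W' : Finset (Fin m)} {f f' : Bits m → Bits m} {s s' d c c' : ℕ}
    (hd : Disjoint W W') (h : HasCircuit W f s d c) (h' : HasCircuit W' f' s' d c') :
    HasCircuit (W ∪ W') (fun x => f' (f x)) (s + s') d (c + c') := by
  obtain ⟨l, h1, h2⟩ := h
  obtain ⟨l', h1', h2'⟩ := h'
  refine ⟨l ++ l', (h1.mono Finset.subset_union_left).append (h1'.mono Finset.subset_union_right),
    ?_, fun e k he w hw => ?_, ?_⟩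
  · rw [List.length_append]; exact add_le_add h2.length_le h2'.length_le
  · rw [finish_append]
    rcases Finset.mem_union.mp hw with hw | hw
    · rw [finish_of_notMem h1'.supp _ (Finset.disjoint_left.mp hd hw)]
      exact h2.finish_le e k (fun w hw => he w (Finset.mem_union_left _ hw)) w hw
    · refine h2'.finish_le _ k (fun w hw => ?_) w hw
      rw [finish_of_notMem h1.supp _ (Finset.disjoint_right.mp hd hw)]
      exact he w (Finset.mem_union_right _ hw)
  · rw [List.countP_append]; exact add_le_add h2.count_le h2'.count_le

lemma hasCircuit_id (W : Finset (Fin m)) : HasCircuit W (fun x => x) 0 0 0 :=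
  ⟨[], ⟨by simp, by simp, fun _ _ _ => rfl⟩, ⟨by simp, fun e k he w hw => by simpa using he w hw,
    by simp⟩⟩

lemma bounded_singleton (g : PlacedGate m) (W : Finset (Fin m)) (hg : g.wireSet ⊆ W) :
    Bounded [g] W 1 1 (if g.gate.nonClifford then 1 else 0) where
  length_le := by simp
  finish_le e k he w hw := by
    rw [finish_cons, finish_nil]
    unfold PlacedGate.advance
    split_ifs with h
    · exact Nat.add_le_add_right (Finset.sup_le fun v hv => he v (hg hv)) 1
    · exact (he w hw).trans (Nat.le_succ k)
  count_le := by simp [List.countP_singleton]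

lemma implements_gX {W : Finset (Fin m)} {a : Fin m} (ha : a ∈ W) :
    Implements [gX a] W (fun x => x + unit a) where
  supp := by simpa using ha
  run x := by rw [runList_singleton, apply_gX]
  map_add x y _ := by abel

lemma implements_gCX {W : Finset (Fin m)} {a b : Fin m} (h : a ≠ b) (ha : a ∈ W) (hb : b ∈ W) :
    Implements [gCX a b h] W (fun x => x + Pi.single b (x a)) where
  supp := by simp [Finset.insert_subset_iff, ha, hb]
  run x := by rw [runList_singleton, apply_gCX]
  map_add x y hy := by rw [Pi.add_apply, hy a ha, add_zero]; abel

lemma implements_gCCX {W : Finset (Fin m)} {a b c : Fin m} (hab : a ≠ b) (hac : a ≠ c)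
    (hbc : b ≠ c) (ha : a ∈ W) (hb : b ∈ W) (hc : c ∈ W) :
    Implements [gCCX a b c hab hac hbc] W (fun x => x + Pi.single c (x a * x b)) where
  supp := by simp [Finset.insert_subset_iff, ha, hb, hc]
  run x := by rw [runList_singleton, apply_gCCX]
  map_add x y hy := by
    rw [Pi.add_apply, Pi.add_apply, hy a ha, hy b hb, add_zero, add_zero]; abel

lemma hasCircuit_gX {W : Finset (Fin m)} {a : Fin m} (ha : a ∈ W) :
    HasCircuit W (fun x => x + unit a) 1 1 0 :=
  ⟨_, implements_gX ha, bounded_singleton (gX a) W (by simpa using ha)⟩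

lemma hasCircuit_gCX {W : Finset (Fin m)} {a b : Fin m} (h : a ≠ b) (ha : a ∈ W) (hb : b ∈ W) :
    HasCircuit W (fun x => x + Pi.single b (x a)) 1 1 0 :=
  ⟨_, implements_gCX h ha hb, bounded_singleton (gCX a b h) W
    (by simp [Finset.insert_subset_iff, ha, hb])⟩

lemma hasCircuit_gCCX {W : Finset (Fin m)} {a b c : Fin m} (hab : a ≠ b) (hac : a ≠ c)
    (hbc : b ≠ c) (ha : a ∈ W) (hb : b ∈ W) (hc : c ∈ W) :
    HasCircuit W (fun x => x + Pi.single c (x a * x b)) 1 1 1 :=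
  ⟨_, implements_gCCX hab hac hbc ha hb hc, bounded_singleton (gCCX a b c hab hac hbc) W
    (by simp [Finset.insert_subset_iff, ha, hb, hc])⟩

lemma hasCircuit_add_sum_unit {W : Finset (Fin m)} (I : Finset (Fin m)) (hI : I ⊆ W) :
    HasCircuit W (fun x => x + ∑ i ∈ I, unit i) I.card I.card 0 := by
  induction I using Finset.induction_on with
  | empty => simpa using hasCircuit_id W
  | insert a I ha ih =>
    have h := (ih ((Finset.subset_insert _ _).trans hI)).comp
      (hasCircuit_gX (hI (Finset.mem_insert_self a I)))
    rw [Finset.card_insert_of_notMem ha]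
    convert h using 2 with x
    rw [Finset.sum_insert ha]; abel

/-- A family of `CX` gates none of whose controls is a target. -/
lemma hasCircuit_cx_family {ι : Type*} {W : Finset (Fin m)} (I : Finset ι) (src tgt : ι → Fin m)
    (hs : ∀ i ∈ I, src i ∈ W) (ht : ∀ i ∈ I, tgt i ∈ W)
    (hne : ∀ i ∈ I, ∀ j ∈ I, src i ≠ tgt j) :
    HasCircuit W (fun x => x + ∑ i ∈ I, Pi.single (tgt i) (x (src i))) I.card I.card 0 := by
  classical
  induction I using Finset.induction_on with
  | empty => simpa using hasCircuit_id W
  | insert a I ha ih =>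
    have h := (ih (fun i hi => hs i (by simp [hi])) (fun i hi => ht i (by simp [hi]))
      (fun i hi j hj => hne i (by simp [hi]) j (by simp [hj]))).comp
      (hasCircuit_gCX (hne a (by simp) a (by simp)) (hs a (by simp)) (ht a (by simp)))
    rw [Finset.card_insert_of_notMem ha]
    convert h using 2 with x
    have h0 : (∑ i ∈ I, (Pi.single (tgt i) (x (src i)) : Bits m)) (src a) = 0 := by
      rw [Finset.sum_apply]
      exact Finset.sum_eq_zero fun i hi =>
        Pi.single_eq_of_ne (hne a (by simp) i (by simp [hi])) _
    rw [Finset.sum_insert ha, Pi.add_apply, h0, add_zero]; abel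

/-- A family of `CCX` gates that share the control `q` and whose controls are not targets. -/
lemma hasCircuit_ccx_family {ι : Type*} {W : Finset (Fin m)} (I : Finset ι) (q : Fin m)
    (src tgt : ι → Fin m) (hq : q ∈ W)
    (hs : ∀ i ∈ I, src i ∈ W) (ht : ∀ i ∈ I, tgt i ∈ W)
    (hqs : ∀ i ∈ I, q ≠ src i) (hqt : ∀ i ∈ I, q ≠ tgt i)
    (hne : ∀ i ∈ I, ∀ j ∈ I, src i ≠ tgt j) :
    HasCircuit W (fun x => x + ∑ i ∈ I, Pi.single (tgt i) (x q * x (src i)))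
      I.card I.card I.card := by
  classical
  induction I using Finset.induction_on with
  | empty => simpa using hasCircuit_id W
  | insert a I ha ih =>
    have h := (ih (fun i hi => hs i (by simp [hi])) (fun i hi => ht i (by simp [hi]))
      (fun i hi => hqs i (by simp [hi])) (fun i hi => hqt i (by simp [hi]))
      (fun i hi j hj => hne i (by simp [hi]) j (by simp [hj]))).comp
      (hasCircuit_gCCX (hqs a (by simp)) (hqt a (by simp)) (hne a (by simp) a (by simp))
        hq (hs a (by simp)) (ht a (by simp)))
    rw [Finset.card_insert_of_notMem ha]
    convert h using 2 with x
    have h0 : ∀ w, (∀ i ∈ I, w ≠ tgt i) →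
        (∑ i ∈ I, (Pi.single (tgt i) (x q * x (src i)) : Bits m)) w = 0 := by
      intro w hw
      rw [Finset.sum_apply]
      exact Finset.sum_eq_zero fun i hi => Pi.single_eq_of_ne (hw i hi) _
    rw [Finset.sum_insert ha, Pi.add_apply, Pi.add_apply,
      h0 q (fun i hi => hqt i (by simp [hi])),
      h0 (src a) (fun i hi => hne a (by simp) i (by simp [hi])), add_zero, add_zero]
    abel

/-! ### Linear reversible circuits in linear depth -/

lemma eq_zero_of_ne_one : ∀ t : ZMod 2, t ≠ 1 → t = 0 := by decide

lemma unit_self (w : Fin m) : (unit w : Bits m) w = 1 := Pi.single_eq_same _ _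

lemma unit_of_ne {v w : Fin m} (h : w ≠ v) : (unit v : Bits m) w = 0 := Pi.single_eq_of_ne h _

lemma bits_add_self (x : Bits m) : x + x = 0 := funext fun _ => CharTwo.add_self_eq_zero _

/-- The transvection `x ↦ x + x p • v`, for `v` vanishing at `p`. -/
def shear (p : Fin m) (v : Bits m) (hv : v p = 0) : Bits m ≃ₗ[ZMod 2] Bits m :=
  LinearEquiv.ofInvolutive (LinearMap.id + (LinearMap.proj p).smulRight v) fun x => by
    ext i
    simp only [LinearMap.add_apply, LinearMap.id_coe, id_eq, LinearMap.smulRight_apply,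
      LinearMap.proj_apply, Pi.add_apply, Pi.smul_apply, hv, smul_eq_mul, mul_zero, add_zero]
    rw [add_assoc, CharTwo.add_self_eq_zero, add_zero]

lemma shear_apply (p : Fin m) (v : Bits m) (hv : v p = 0) (x : Bits m) :
    shear p v hv x = x + x p • v := rfl

/-- The `CX` gates with control `p` and targets those `q ≠ p` in the list with `y q = 1`; the last
target of the list is served first. -/
def fan (p : Fin m) (y : Bits m) : List (Fin m) → List (PlacedGate m)
  | [] => []
  | q :: qs => fan p y qs ++ if h : p ≠ q ∧ y q = 1 then [gCX p q h.1] else []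

/-- The circuit which performs, for the wires `p` of the list from the last to the first, the
additions of bit `p` to the bits `q` that follow `p` in the list and satisfy `y p q = 1`. -/
def triangular (y : Fin m → Bits m) : List (Fin m) → List (PlacedGate m)
  | [] => []
  | p :: ps => triangular y ps ++ fan p (y p) ps

lemma fan_supp (p : Fin m) (y : Bits m) (qs : List (Fin m)) :
    ∀ g ∈ fan p y qs, g.wireSet ⊆ insert p qs.toFinset := by
  induction qs with
  | nil => simp [fan]
  | cons q qs ih =>
    intro g hg
    rcases List.mem_append.mp hg with hg | hg
    · refine (ih g hg).trans (Finset.insert_subset_insert _ ?_)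
      rw [List.toFinset_cons]; exact Finset.subset_insert _ _
    · split_ifs at hg with h
      · rw [List.mem_singleton.mp hg]
        simp [Finset.insert_subset_iff]
      · simp at hg

lemma fan_implements (p : Fin m) (y : Bits m) (qs : List (Fin m)) (hp : p ∉ qs) (hqs : qs.Nodup)
    (W : Finset (Fin m)) (hpW : p ∈ W) (hW : ∀ q ∈ qs, q ∈ W) :
    Implements (fan p y qs) W (fun x => x + x p • fun w => if w ∈ qs then y w else 0) := by
  induction qs with
  | nil =>
    refine ⟨by simp [fan], fun x => ?_, fun x z _ => ?_⟩
    · have : (fun w : Fin m => if w ∈ ([] : List (Fin m)) then y w else 0) = 0 := by ext; simp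
      rw [this]; simp [fan]
    · ext i; simp
  | cons q qs ih =>
    have hpq : p ≠ q := fun h => hp (by simp [h])
    have hp' : p ∉ qs := fun h => hp (by simp [h])
    have hq : q ∉ qs := (List.nodup_cons.mp hqs).1
    have ih' := ih hp' (List.nodup_cons.mp hqs).2 (fun q hq => hW q (by simp [hq]))
    by_cases h : y q = 1
    · have h1 := ih'.append (implements_gCX hpq hpW (hW q (by simp)))
      have h2 : fan p y (q :: qs) = fan p y qs ++ [gCX p q hpq] := by simp [fan, h, hpq]
      rw [h2]
      convert h1 using 2 with x
      ext i
      have hpv : (fun w => if w ∈ qs then y w else 0) p = 0 := if_neg hp'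
      simp only [Pi.add_apply, Pi.smul_apply, smul_eq_mul, if_neg hp', mul_zero, add_zero]
      by_cases hi : i = q
      · subst hi; simp [hq, h]
      · simp [hi]
    · have h0 : y q = 0 := eq_zero_of_ne_one _ h
      have h2 : fan p y (q :: qs) = fan p y qs := by simp [fan, h]
      rw [h2]
      convert ih' using 5 with x w
      by_cases hw : w = q
      · subst hw; simp [hq, h0]
      · simp [hw]

lemma fan_length_le (p : Fin m) (y : Bits m) (qs : List (Fin m)) :
    (fan p y qs).length ≤ qs.length := by
  induction qs with
  | nil => simp [fan]
  | cons q qs ih =>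
    rw [fan, List.length_append, List.length_cons]
    split_ifs <;> simp <;> omega

lemma fan_countP (p : Fin m) (y : Bits m) (qs : List (Fin m)) :
    (fan p y qs).countP (fun g => g.gate.nonClifford) = 0 := by
  induction qs with
  | nil => simp [fan]
  | cons q qs ih =>
    rw [fan, List.countP_append, ih]
    split_ifs <;> simp [gCX, Gate.nonClifford]

/-- The profile `d` on a list of wires is below a staircase that descends along the list with
slope one and reaches `M` at its last element. -/
def Stair (d : Fin m → ℕ) (M : ℕ) : List (Fin m) → Prop
  | [] => True
  | q :: qs => d q ≤ M + qs.length ∧ Stair d M qs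

lemma Stair.mono {d d' : Fin m → ℕ} {M M' : ℕ} {qs : List (Fin m)} (h : Stair d M qs)
    (hM : M ≤ M') (hd : ∀ q ∈ qs, d' q = d q) : Stair d' M' qs := by
  induction qs with
  | nil => trivial
  | cons q qs ih =>
    refine ⟨?_, ih h.2 fun q hq => hd q (by simp [hq])⟩
    rw [hd q (by simp)]; exact h.1.trans (by omega)

lemma Stair.le {d : Fin m → ℕ} {M : ℕ} {qs : List (Fin m)} (h : Stair d M qs) :
    ∀ q ∈ qs, d q ≤ M + qs.length := by
  induction qs with
  | nil => simp
  | cons q qs ih =>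
    intro q' hq'
    rw [List.length_cons]
    rcases List.mem_cons.mp hq' with rfl | hq'
    · exact h.1.trans (by omega)
    · exact (ih h.2 q' hq').trans (by omega)

/-- A fan raises the staircase by one only: it visits the targets in the order in which they
become idle. This is the pipelining that keeps triangular circuits in linear depth. -/
lemma fan_stair (p : Fin m) (y : Bits m) (qs : List (Fin m)) (hp : p ∉ qs) (hqs : qs.Nodup)
    (d : Fin m → ℕ) (M : ℕ) (hd : Stair d M qs) (hdp : d p ≤ M) :
    Stair (finish (fan p y qs) d) (M + 1) qs ∧ finish (fan p y qs) d p ≤ M + qs.length := by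
  induction qs with
  | nil => exact ⟨trivial, by simpa [fan] using hdp⟩
  | cons q qs ih =>
    have hpq : p ≠ q := fun h => hp (by simp [h])
    have hp' : p ∉ qs := fun h => hp (by simp [h])
    have hq : q ∉ qs := (List.nodup_cons.mp hqs).1
    obtain ⟨ih1, ih2⟩ := ih hp' (List.nodup_cons.mp hqs).2 hd.2
    have hdq : finish (fan p y qs) d q = d q :=
      finish_of_notMem (fan_supp p y qs) d (by simp [hpq.symm, hq])
    have hdq' := hd.1
    rw [fan, finish_append]
    generalize finish (fan p y qs) d = e at *
    rw [List.length_cons]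
    split_ifs with h
    · rw [finish_cons, finish_nil]
      have hsup : (gCX p q h.1).wireSet.sup e ≤ M + qs.length := by
        rw [wireSet_gCX]
        simp only [Finset.sup_insert, Finset.sup_singleton, sup_le_iff]
        exact ⟨ih2, hdq ▸ hdq'⟩
      have hadv : ∀ w, w = p ∨ w = q → (gCX p q h.1).advance e w ≤ M + qs.length + 1 := by
        intro w hw
        unfold PlacedGate.advance
        rw [if_pos (by simpa using hw)]; omega
      refine ⟨⟨by have := hadv q (Or.inr rfl); omega, ih1.mono le_rfl fun w hw => ?_⟩,
        hadv p (Or.inl rfl)⟩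
      refine PlacedGate.advance_of_notMem _ _ ?_
      rw [wireSet_gCX, Finset.mem_insert, Finset.mem_singleton]
      rintro (rfl | rfl)
      · exact hp' hw
      · exact hq hw
    · rw [finish_nil]
      exact ⟨⟨by rw [hdq]; omega, ih1⟩, by omega⟩

lemma triangular_supp (y : Fin m → Bits m) (ps : List (Fin m)) :
    ∀ g ∈ triangular y ps, g.wireSet ⊆ ps.toFinset := by
  induction ps with
  | nil => simp [triangular]
  | cons p ps ih =>
    intro g hg
    rw [List.toFinset_cons]
    rcases List.mem_append.mp hg with hg | hg
    · exact (ih g hg).trans (Finset.subset_insert _ _)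
    · exact fan_supp p _ ps g hg

lemma triangular_stair (y : Fin m → Bits m) (ps : List (Fin m)) (hps : ps.Nodup) (d : Fin m → ℕ)
    (k : ℕ) (hd : ∀ p ∈ ps, d p ≤ k) :
    Stair (finish (triangular y ps) d) (k + ps.length) ps := by
  induction ps with
  | nil => trivial
  | cons p ps ih =>
    obtain ⟨hp, hps'⟩ := List.nodup_cons.mp hps
    have h1 := ih hps' fun p hp => hd p (by simp [hp])
    have h2 : finish (triangular y ps) d p = d p :=
      finish_of_notMem (triangular_supp y ps) d (by simpa using hp)
    have h3 := hd p (by simp)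
    obtain ⟨h4, h5⟩ := fan_stair p (y p) ps hp hps' _ _ h1 (by omega)
    rw [triangular, finish_append, List.length_cons]
    exact ⟨by omega, h4.mono (by omega) fun _ _ => rfl⟩

lemma triangular_countP (y : Fin m → Bits m) (ps : List (Fin m)) :
    (triangular y ps).countP (fun g => g.gate.nonClifford) = 0 := by
  induction ps with
  | nil => simp [triangular]
  | cons p ps ih => rw [triangular, List.countP_append, ih, fan_countP]

lemma fan_unit (p : Fin m) (qs : List (Fin m)) (hp : p ∉ qs) : fan p (unit p) qs = [] := by
  induction qs with
  | nil => rfl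
  | cons q qs ih =>
    have hpq : p ≠ q := fun h => hp (by simp [h])
    rw [fan, ih (fun h => hp (by simp [h]))]
    simp [hpq.symm]

lemma triangular_length_le (y : Fin m → Bits m) (ps : List (Fin m)) (hps : ps.Nodup) (k : ℕ)
    (hk : ps.length ≤ k) :
    (triangular y ps).length ≤ ps.countP (fun p => y p ≠ unit p) * k := by
  induction ps with
  | nil => simp [triangular]
  | cons p ps ih =>
    obtain ⟨hp, hps'⟩ := List.nodup_cons.mp hps
    rw [List.length_cons] at hk
    have h1 := ih hps' (by omega)
    rw [triangular, List.length_append, List.countP_cons]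
    by_cases h : y p = unit p
    · rw [h, fan_unit p ps hp]; simpa using h1
    · have := fan_length_le p (y p) ps
      simp only [ne_eq, h, not_false_eq_true, decide_true, if_true, add_mul, one_mul]
      simp only [ne_eq] at h1
      omega

/-- The circuit `triangular y ps` maps `e_p` to `y p`, if these vectors are unitriangular with
respect to the order of the list `ps`. -/
lemma triangular_implements (y : Fin m → Bits m) (ps : List (Fin m)) (hps : ps.Nodup)
    (W : Finset (Fin m)) (hW : ∀ p ∈ ps, p ∈ W) (h1 : ∀ p ∈ ps, y p p = 1)
    (h0 : ∀ p ∈ ps, ∀ w, w ∉ ps → y p w = 0) (htri : ps.Pairwise fun p q => y q p = 0) :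
    ∃ Λ : Bits m ≃ₗ[ZMod 2] Bits m, Implements (triangular y ps) W Λ ∧
      (∀ p ∈ ps, Λ (unit p) = y p) ∧ ∀ x : Bits m, (∀ p ∈ ps, x p = 0) → Λ x = x := by
  induction ps with
  | nil =>
    exact ⟨LinearEquiv.refl _ _, ⟨by simp [triangular], by simp [triangular],
      fun _ _ _ => rfl⟩, by simp, fun _ _ => rfl⟩
  | cons p ps ih =>
    obtain ⟨hp, hps'⟩ := List.nodup_cons.mp hps
    obtain ⟨hpt, htri'⟩ := List.pairwise_cons.mp htri
    obtain ⟨Λ, hΛ, hΛ1, hΛ0⟩ := ih hps' (fun q hq => hW q (by simp [hq]))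
      (fun q hq => h1 q (by simp [hq]))
      (fun q hq w hw => by
        by_cases hwp : w = p
        · subst hwp; exact hpt q hq
        · exact h0 q (by simp [hq]) w (by simp [hw, hwp])) htri'
    have hf := fan_implements p (y p) ps hp hps' W (hW p (by simp))
      (fun q hq => hW q (by simp [hq]))
    refine ⟨Λ.trans (shear p (fun w => if w ∈ ps then y p w else 0) (if_neg hp)),
      hΛ.append hf, fun q hq => ?_, fun x hx => ?_⟩
    · rw [LinearEquiv.trans_apply, shear_apply]
      by_cases hqp : q = p
      · subst hqp
        rw [hΛ0 (unit q) fun w hw => Pi.single_eq_of_ne (fun h => hp (by rw [← h]; exact hw)) _]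
        ext w
        by_cases hw : w = q
        · subst hw; simp [hp, h1]
        · by_cases hw' : w ∈ ps
          · simp [hw, hw']
          · simp [hw, hw', h0 q (by simp) w (by simp [hw, hw'])]
      · have hq' : q ∈ ps := by simpa [hqp] using hq
        rw [hΛ1 q hq', hpt q hq', zero_smul, add_zero]
    · rw [LinearEquiv.trans_apply, shear_apply, hΛ0 x fun q hq => hx q (by simp [hq]),
        hx p (by simp), zero_smul, add_zero]

/-- The triangular map with columns `y p` has a circuit whose size is the number of nontrivial
columns times the number of wires, and whose depth is linear in the number of wires. -/
lemma hasCircuit_triangular (y : Fin m → Bits m) (ps : List (Fin m)) (hps : ps.Nodup)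
    (W : Finset (Fin m)) (hW : ∀ p ∈ ps, p ∈ W) (h1 : ∀ p ∈ ps, y p p = 1)
    (h0 : ∀ p ∈ ps, ∀ w, w ∉ ps → y p w = 0) (htri : ps.Pairwise fun p q => y q p = 0) :
    ∃ Λ : Bits m ≃ₗ[ZMod 2] Bits m,
      HasCircuit W Λ (ps.countP (fun p => y p ≠ unit p) * ps.length) (2 * ps.length) 0 ∧
      ∀ p ∈ ps, Λ (unit p) = y p := by
  obtain ⟨Λ, hΛ, hΛ1, -⟩ := triangular_implements y ps hps W hW h1 h0 htri
  refine ⟨Λ, ⟨_, hΛ, triangular_length_le y ps hps _ le_rfl, fun e k he w hw => ?_,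
    (triangular_countP y ps).le⟩, hΛ1⟩
  by_cases hw' : w ∈ ps
  · have := (triangular_stair y ps hps e k fun p hp => he p (hW p hp)).le w hw'
    omega
  · rw [finish_of_notMem (triangular_supp y ps) e (by simpa using hw')]
    exact (he w hw).trans (by omega)

/-- Gaussian elimination: linearly independent vectors `z i` are a unitriangular combination of
vectors `y i` in echelon form, `π i` being the position of the pivot of `y i`. -/
lemma exists_echelon {r : ℕ} (z : Fin r → Bits m) (hz : LinearIndependent (ZMod 2) z) :
    ∃ (π : Fin r → Fin m) (y : Fin r → Bits m) (c : Fin r → Fin r → ZMod 2),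
      (∀ i, y i (π i) = 1) ∧ (∀ i j, j < i → y i (π j) = 0) ∧
      (∀ i, y i ∈ Submodule.span (ZMod 2) (Set.range z)) ∧
      ∀ i, z i = y i + ∑ j ∈ Finset.univ.filter (· < i), c i j • y j := by
  induction r with
  | zero => exact ⟨fun i => i.elim0, fun i => i.elim0, fun i => i.elim0, fun i => i.elim0,
      fun i => i.elim0, fun i => i.elim0, fun i => i.elim0⟩
  | succ r ih =>
    obtain ⟨p, hp⟩ : ∃ p, z 0 p = 1 := by
      by_contra hcon
      push Not at hcon
      refine hz.ne_zero 0 (funext fun p => ?_)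
      exact eq_zero_of_ne_one _ (hcon p)
    -- clear the position `p` in the other vectors
    set z' : Fin r → Bits m := fun i => z i.succ + z i.succ p • z 0 with hz'
    have hspan : ∀ i, z' i ∈ Submodule.span (ZMod 2) (Set.range z) := fun i =>
      add_mem (Submodule.subset_span ⟨_, rfl⟩)
        (Submodule.smul_mem _ _ (Submodule.subset_span ⟨_, rfl⟩))
    have hli : LinearIndependent (ZMod 2) z' := by
      rw [Fintype.linearIndependent_iff] at hz ⊢
      intro g hg i
      have := hz (Fin.cons (∑ i, g i * z i.succ p) g) (by
        rw [Fin.sum_univ_succ]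
        simp only [Fin.cons_zero, Fin.cons_succ]
        rw [← hg]
        simp only [hz', smul_add, Finset.sum_add_distrib, smul_smul, Finset.sum_smul]
        abel) i.succ
      simpa using this
    obtain ⟨π, y, c, h1, h2, h3, h4⟩ := ih z' hli
    have hzero : ∀ i, y i p = 0 := by
      intro i
      have hle : Submodule.span (ZMod 2) (Set.range z') ≤
          LinearMap.ker (LinearMap.proj (R := ZMod 2) (φ := fun _ : Fin m => ZMod 2) p) := by
        rw [Submodule.span_le]
        rintro _ ⟨j, rfl⟩
        simp only [SetLike.mem_coe, LinearMap.mem_ker, LinearMap.proj_apply, hz', Pi.add_apply,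
          Pi.smul_apply, hp, smul_eq_mul, mul_one]
        exact CharTwo.add_self_eq_zero _
      exact hle (h3 i)
    refine ⟨Fin.cons p π, Fin.cons (z 0) y,
      fun i j => Fin.cases 0 (fun i' => Fin.cases (z i'.succ p) (fun j' => c i' j') j) i,
      ?_, ?_, ?_, ?_⟩
    · intro i
      refine Fin.cases ?_ (fun i => ?_) i
      · simpa using hp
      · simpa using h1 i
    · intro i j
      refine Fin.cases ?_ (fun i => ?_) i
      · intro h; exact absurd h (Fin.not_lt_zero j)
      · refine Fin.cases ?_ (fun j => ?_) j
        · intro _; simpa using hzero i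
        · intro h; simpa using h2 i j (by simpa using h)
    · intro i
      refine Fin.cases ?_ (fun i => ?_) i
      · rw [Fin.cons_zero]; exact Submodule.subset_span ⟨0, rfl⟩
      · rw [Fin.cons_succ]
        exact (Submodule.span_le.mpr (by rintro _ ⟨j, rfl⟩; exact hspan j)) (h3 i)
    · intro i
      refine Fin.cases ?_ (fun i => ?_) i
      · simp
      · have h5 := h4 i
        rw [Finset.sum_filter] at h5 ⊢
        rw [Fin.sum_univ_succ]
        simp only [Fin.cons_zero, Fin.cons_succ, Fin.cases_succ, Fin.cases_zero, Fin.succ_pos,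
          if_true, Fin.succ_lt_succ_iff]
        rw [add_left_comm, ← h5]
        simp only [hz']
        rw [add_left_comm, bits_add_self, add_zero]

/-- Linearly independent vectors supported in `W` are the images of one-hot strings under a
linear circuit on `W`, whose depth is linear in the number of wires. -/
theorem exists_linear_circuit {ι : Type*} [Fintype ι] (W : Finset (Fin m)) (z : ι → Bits m)
    (hz : LinearIndependent (ZMod 2) z) (hzW : ∀ i, ∀ w, w ∉ W → z i w = 0) :
    ∃ (π : ι → Fin m) (Λ : Bits m ≃ₗ[ZMod 2] Bits m), Function.Injective π ∧ (∀ i, π i ∈ W) ∧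
      (∀ i, Λ (unit (π i)) = z i) ∧
      HasCircuit W Λ (2 * (Fintype.card ι * W.card)) (4 * W.card) 0 := by
  classical
  set r := Fintype.card ι with hr
  let e : Fin r ≃ ι := (Fintype.equivFin ι).symm
  obtain ⟨π, y, c, h1, h2, h3, h4⟩ := exists_echelon (z ∘ e) (hz.comp e e.injective)
  have hyW : ∀ i, ∀ w, w ∉ W → y i w = 0 := by
    intro i w hw
    have hle : Submodule.span (ZMod 2) (Set.range (z ∘ e)) ≤
        LinearMap.ker (LinearMap.proj (R := ZMod 2) (φ := fun _ : Fin m => ZMod 2) w) := by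
      rw [Submodule.span_le]
      rintro _ ⟨j, rfl⟩
      exact hzW _ w hw
    exact hle (h3 i)
  have hπW : ∀ i, π i ∈ W := by
    intro i; by_contra h
    have := hyW i _ h
    rw [h1 i] at this; exact one_ne_zero this
  have hπ : Function.Injective π := by
    intro i j hij
    rcases lt_trichotomy i j with h | h | h
    · have := h2 j i h
      rw [hij, h1 j] at this; exact absurd this one_ne_zero
    · exact h
    · have := h2 i j h
      rw [← hij, h1 i] at this; exact absurd this one_ne_zero
  have hrW : r ≤ W.card := by
    have := Finset.card_le_card_of_injOn π (s := Finset.univ) (t := W) (fun i _ => hπW i)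
      hπ.injOn
    simpa using this
  have hu : ∀ i j, i ≠ j → (unit (π i) : Bits m) (π j) = 0 := fun i j h =>
    Pi.single_eq_of_ne (fun h' => h (hπ h').symm) _
  -- the upper triangular factor, on the pivots only
  set u : Fin r → Bits m := fun i =>
    unit (π i) + ∑ j ∈ Finset.univ.filter (· < i), c i j • (unit (π j) : Bits m)
  have hudef : ∀ i, u i = unit (π i) +
      ∑ j ∈ Finset.univ.filter (· < i), c i j • (unit (π j) : Bits m) := fun i => rfl
  have huπ : ∀ i, Function.extend π u unit (π i) = u i := hπ.extend_apply u _
  obtain ⟨U, hU, hU1⟩ := hasCircuit_triangular (Function.extend π u unit)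
    (List.ofFn π).reverse (by simpa using List.nodup_ofFn.mpr hπ) W
    (by
      intro p hp
      obtain ⟨i, rfl⟩ : ∃ i, π i = p := by simpa [List.mem_ofFn] using hp
      exact hπW i)
    (by
      intro p hp
      obtain ⟨i, rfl⟩ : ∃ i, π i = p := by simpa [List.mem_ofFn] using hp
      rw [huπ, hudef, Pi.add_apply, Finset.sum_apply, unit_self, Finset.sum_eq_zero,
        add_zero]
      intro j hj
      rw [Pi.smul_apply, hu j i (Finset.mem_filter.mp hj).2.ne, smul_zero])
    (by
      intro p hp w hw
      obtain ⟨i, rfl⟩ : ∃ i, π i = p := by simpa [List.mem_ofFn] using hp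
      have hw' : ∀ i, (unit (π i) : Bits m) w = 0 := by
        intro i; refine Pi.single_eq_of_ne (fun h => hw ?_) _; simp [List.mem_ofFn, h]
      rw [huπ, hudef, Pi.add_apply, Finset.sum_apply, hw', zero_add]
      exact Finset.sum_eq_zero fun j _ => by rw [Pi.smul_apply, hw', smul_zero])
    (by
      rw [List.pairwise_reverse, List.pairwise_ofFn]
      intro i j hij
      rw [huπ, hudef, Pi.add_apply, Finset.sum_apply, hu i j hij.ne, zero_add]
      refine Finset.sum_eq_zero fun j' hj' => ?_
      rw [Pi.smul_apply, hu j' j ((Finset.mem_filter.mp hj').2.trans hij).ne, smul_zero])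
  -- the lower triangular factor, from the pivots to all wires
  have hmem : ∀ w, w ∈ List.ofFn π ++ (W \ Finset.univ.image π).toList ↔ w ∈ W := by
    intro w
    simp only [List.mem_append, List.mem_ofFn, Finset.mem_toList, Finset.mem_sdiff,
      Finset.mem_image, Finset.mem_univ, true_and]
    constructor
    · rintro (⟨i, rfl⟩ | h)
      · exact hπW i
      · exact h.1
    · intro h
      by_cases h' : ∃ i, π i = w
      · exact Or.inl h'
      · exact Or.inr ⟨h, h'⟩
  have hnd : (List.ofFn π ++ (W \ Finset.univ.image π).toList).Nodup := by
    refine List.nodup_append.mpr ⟨List.nodup_ofFn.mpr hπ, Finset.nodup_toList _, ?_⟩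
    rintro a ha b hb rfl
    obtain ⟨i, rfl⟩ := List.mem_ofFn.mp ha
    simp at hb
  have hlen : (List.ofFn π ++ (W \ Finset.univ.image π).toList).length = W.card := by
    rw [← List.toFinset_card_of_nodup hnd]
    congr 1
    ext w
    rw [List.mem_toFinset, hmem]
  have hVπ : ∀ i, Function.extend π y unit (π i) = y i := hπ.extend_apply y _
  have hVu : ∀ w, (∀ i, π i ≠ w) → Function.extend π y unit w = unit w :=
    fun w hw => Function.extend_apply' _ _ _ fun ⟨i, hi⟩ => hw i hi
  have hout : ∀ w ∈ (W \ Finset.univ.image π).toList, ∀ i, π i ≠ w := by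
    intro w hw i h
    simp only [Finset.mem_toList, Finset.mem_sdiff, Finset.mem_image, Finset.mem_univ,
      true_and] at hw
    exact hw.2 ⟨i, h⟩
  obtain ⟨V, hV, hV1⟩ := hasCircuit_triangular (Function.extend π y unit)
    (List.ofFn π ++ (W \ Finset.univ.image π).toList) hnd W (fun p hp => (hmem p).mp hp)
    (by
      intro p _
      by_cases h : ∃ i, π i = p
      · obtain ⟨i, rfl⟩ := h
        rw [hVπ, h1]
      · rw [hVu p (fun i hi => h ⟨i, hi⟩)]; exact unit_self p)
    (by
      intro p hp w hw
      rw [hmem] at hp hw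
      by_cases h : ∃ i, π i = p
      · obtain ⟨i, rfl⟩ := h
        rw [hVπ, hyW i w hw]
      · rw [hVu p (fun i hi => h ⟨i, hi⟩)]
        exact Pi.single_eq_of_ne (fun h' : w = p => hw (h' ▸ hp)) _)
    (by
      rw [List.pairwise_append, List.pairwise_ofFn]
      refine ⟨fun i j hij => ?_, ?_, ?_⟩
      · rw [hVπ]; exact h2 j i hij
      · refine (Finset.nodup_toList _).pairwise_of_forall_ne fun a ha b hb hab => ?_
        rw [hVu b (hout b hb)]
        exact Pi.single_eq_of_ne hab _
      · intro a ha b hb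
        obtain ⟨i, rfl⟩ := List.mem_ofFn.mp ha
        rw [hVu b (hout b hb)]
        exact Pi.single_eq_of_ne (hout b hb i) _)
  refine ⟨π ∘ e.symm, U.trans V, hπ.comp e.symm.injective, fun i => hπW _, fun i => ?_, ?_⟩
  · have hV2 : ∀ j, V (unit (π j)) = y j := by
      intro j
      rw [hV1 (π j) ((hmem _).mpr (hπW j)), hVπ]
    rw [LinearEquiv.trans_apply, Function.comp_apply, hU1 _ (by simp [List.mem_ofFn]), huπ, hudef,
      map_add, map_sum]
    simp only [map_smul, hV2]
    rw [← h4]; simp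
  · have hcU := List.countP_le_length (l := (List.ofFn π).reverse)
      (p := fun p => decide (Function.extend π u unit p ≠ unit p))
    have hcV : (List.ofFn π ++ (W \ Finset.univ.image π).toList).countP
        (fun p => decide (Function.extend π y unit p ≠ unit p)) ≤ r := by
      rw [List.countP_append, (List.countP_eq_zero (l := (W \ Finset.univ.image π).toList)).mpr,
        add_zero]
      · refine List.countP_le_length.trans ?_
        simp
      · intro w hw
        simpa using hVu w (hout w hw)
    refine (hU.comp hV).mono (Finset.Subset.refl _) ?_ ?_ le_rfl
    · rw [hlen]
      rw [List.length_reverse, List.length_ofFn] at hcU ⊢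
      have e1 := Nat.mul_le_mul hcU hrW
      have e2 := Nat.mul_le_mul_right W.card hcV
      rw [two_mul]
      exact add_le_add e1 e2
    · rw [hlen, List.length_reverse, List.length_ofFn]; omega

/-! ### A balanced linear functional -/

/-- The sign `(-1)^t` of a bit. -/
def bitSign (t : ZMod 2) : ℤ := if t = 0 then 1 else -1

lemma bitSign_add : ∀ s t : ZMod 2, bitSign (s + t) = bitSign s * bitSign t := by decide

lemma bitSign_add_one (s : ZMod 2) : bitSign (s + 1) = -bitSign s := by
  rw [bitSign_add]; simp [bitSign]

/-- Orthogonality of characters. -/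
lemma sum_bitSign_dotProduct (z : Bits m) :
    ∑ a : Bits m, bitSign (a ⬝ᵥ z) = if z = 0 then (Fintype.card (Bits m) : ℤ) else 0 := by
  split_ifs with h
  · subst h; simp [bitSign]
  · obtain ⟨i, hi⟩ : ∃ i, z i = 1 := by
      by_contra hcon
      push Not at hcon
      exact h (funext fun i => eq_zero_of_ne_one _ (hcon i))
    refine Finset.sum_involution (fun a _ => a + unit i) (fun a _ => ?_) (fun a _ _ h' => ?_)
      (fun _ _ => Finset.mem_univ _) (fun a _ => ?_)
    · rw [add_dotProduct, single_dotProduct, hi, one_mul, bitSign_add_one, add_neg_cancel]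
    · have := congrFun (add_eq_left.mp h') i
      rw [unit_self] at this; exact one_ne_zero this
    · rw [add_assoc, bits_add_self, add_zero]

/-- Some linear functional splits a set of at least two bit strings into two parts of at most
three quarters of its size: over all functionals, the mean of the squared difference of the sizes
of the two parts is the size of the set. -/
theorem exists_balanced (S : Finset (Bits m)) (hS : 2 ≤ S.card) :
    ∃ a : Bits m, 4 * (S.filter fun x => a ⬝ᵥ x = 0).card ≤ 3 * S.card ∧
      4 * (S.filter fun x => a ⬝ᵥ x = 1).card ≤ 3 * S.card := by
  have hsum : ∑ a : Bits m, (∑ x ∈ S, bitSign (a ⬝ᵥ x)) ^ 2 =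
      ∑ _a : Bits m, (S.card : ℤ) := by
    simp_rw [sq, Finset.sum_mul_sum, ← bitSign_add, ← dotProduct_add]
    rw [Finset.sum_comm]
    simp_rw [Finset.sum_comm (s := Finset.univ) (t := S), sum_bitSign_dotProduct]
    have : ∀ x ∈ S, (∑ y ∈ S, if x + y = 0 then (Fintype.card (Bits m) : ℤ) else 0) =
        Fintype.card (Bits m) := by
      intro x hx
      rw [Finset.sum_eq_single_of_mem x hx, if_pos (bits_add_self x)]
      intro y _ hy
      refine if_neg fun h => hy ?_
      rw [← add_zero y, ← bits_add_self x, ← add_assoc, add_comm y x, h, zero_add]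
    rw [Finset.sum_congr rfl this]
    simp [mul_comm]
  obtain ⟨a, -, ha⟩ := Finset.exists_le_of_sum_le Finset.univ_nonempty hsum.le
  refine ⟨a, ?_⟩
  have h1 : ∑ x ∈ S, bitSign (a ⬝ᵥ x) =
      ((S.filter fun x => a ⬝ᵥ x = 0).card : ℤ) - (S.filter fun x => a ⬝ᵥ x = 1).card := by
    have : ∀ t : ZMod 2, bitSign t = (if t = 0 then 1 else 0) - if t = 1 then 1 else 0 := by
      decide
    simp_rw [this, Finset.sum_sub_distrib, Finset.card_filter]
    push_cast; rfl
  have h2 : (S.card : ℤ) =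
      (S.filter fun x => a ⬝ᵥ x = 0).card + (S.filter fun x => a ⬝ᵥ x = 1).card := by
    have : ∀ t : ZMod 2, (1 : ℤ) = (if t = 0 then 1 else 0) + if t = 1 then 1 else 0 := by decide
    rw [Finset.card_eq_sum_ones]
    push_cast
    rw [Finset.sum_congr rfl fun x _ => this (a ⬝ᵥ x), Finset.sum_add_distrib,
      Finset.card_filter, Finset.card_filter]
    push_cast; rfl
  rw [h1] at ha
  zify
  zify at hS
  generalize ((S.filter fun x => a ⬝ᵥ x = 0).card : ℤ) = p at *
  generalize ((S.filter fun x => a ⬝ᵥ x = 1).card : ℤ) = q at *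
  have h3 : (2 * (p - q)) ^ 2 ≤ S.card ^ 2 ∨ (S.card : ℤ) < 4 := by
    by_cases h : (S.card : ℤ) < 4
    · exact Or.inr h
    · left; nlinarith
  rcases h3 with h3 | h3
  · have := abs_le_of_sq_le_sq' h3 (by omega)
    constructor <;> linarith [this.1, this.2]
  · have h5 : p - q ≤ 1 := by nlinarith
    have h6 : -1 ≤ p - q := by nlinarith
    constructor <;> omega

/-! ### From one-hot strings to arbitrary strings -/

/-- Bases of two subspaces that extend a common basis `u` of their intersection. -/
lemma exists_adapted_family {K V : Type*} [Field K] [AddCommGroup V] [Module K V]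
    [FiniteDimensional K V] (A₀ A₁ : Submodule K V) :
    ∃ (c a b : ℕ) (u : Fin c → V) (v : Fin a → V) (w : Fin b → V),
      LinearIndependent K (Sum.elim (Sum.elim u v) w) ∧
      Submodule.span K (Set.range u) ⊔ Submodule.span K (Set.range v) = A₀ ∧
      Submodule.span K (Set.range u) ⊔ Submodule.span K (Set.range w) = A₁ ∧
      Module.finrank K A₀ = c + a ∧ Module.finrank K A₁ = c + b := by
  obtain ⟨C, hC⟩ := exists_isCompl (A₀ ⊓ A₁)
  have hfam : ∀ A : Submodule K V, ∃ (k : ℕ) (u : Fin k → V), LinearIndependent K u ∧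
      Submodule.span K (Set.range u) = A := by
    intro A
    let B := Module.finBasis K A
    refine ⟨_, fun i => (B i : V), B.linearIndependent.map' A.subtype (Submodule.ker_subtype A), ?_⟩
    have : Set.range (fun i => (B i : V)) = A.subtype '' Set.range B := by
      rw [← Set.range_comp]; rfl
    rw [this, Submodule.span_image, B.span_eq, Submodule.map_top, Submodule.range_subtype]
  obtain ⟨c, u, hu, hus⟩ := hfam (A₀ ⊓ A₁)
  obtain ⟨a, v, hv, hvs⟩ := hfam (A₀ ⊓ C)
  obtain ⟨b, w, hw, hws⟩ := hfam (A₁ ⊓ C)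
  have hmod : ∀ A : Submodule K V, A₀ ⊓ A₁ ≤ A → (A₀ ⊓ A₁) ⊔ (A ⊓ C) = A := by
    intro A hA
    rw [inf_comm A C, ← sup_inf_assoc_of_le C hA, hC.sup_eq_top, top_inf_eq]
  have h0 := hmod A₀ inf_le_left
  have h1 := hmod A₁ inf_le_right
  have huv : LinearIndependent K (Sum.elim u v) := by
    refine hu.sum_type hv ?_
    rw [hus, hvs]
    exact hC.disjoint.mono_right inf_le_right
  have huw : LinearIndependent K (Sum.elim u w) := by
    refine hu.sum_type hw ?_
    rw [hus, hws]
    exact hC.disjoint.mono_right inf_le_right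
  have hsp0 : Submodule.span K (Set.range (Sum.elim u v)) = A₀ := by
    rw [Set.Sum.elim_range, Submodule.span_union, hus, hvs, h0]
  have hsp1 : Submodule.span K (Set.range (Sum.elim u w)) = A₁ := by
    rw [Set.Sum.elim_range, Submodule.span_union, hus, hws, h1]
  refine ⟨c, a, b, u, v, w, huv.sum_type hw ?_, by rw [hus, hvs, h0], by rw [hus, hws, h1], ?_, ?_⟩
  · rw [hsp0, hws, Submodule.disjoint_def]
    intro x hx0 hx1
    exact Submodule.disjoint_def.mp hC.disjoint x ⟨hx0, hx1.1⟩ hx1.2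
  · rw [← hsp0, finrank_span_eq_card huv]; simp
  · rw [← hsp1, finrank_span_eq_card huw]; simp

/-- The bit strings that vanish outside `P`. -/
def supportedOn (P : Finset (Fin m)) : Submodule (ZMod 2) (Bits m) where
  carrier := {x | ∀ w, w ∉ P → x w = 0}
  add_mem' {x y} hx hy w hw := by rw [Pi.add_apply, hx w hw, hy w hw, add_zero]
  zero_mem' _ _ := rfl
  smul_mem' c x hx w hw := by rw [Pi.smul_apply, hx w hw, smul_zero]

lemma mem_supportedOn {P : Finset (Fin m)} {x : Bits m} :
    x ∈ supportedOn P ↔ ∀ w, w ∉ P → x w = 0 := Iff.rfl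

lemma unit_mem_supportedOn {P : Finset (Fin m)} {w : Fin m} (h : w ∈ P) :
    unit w ∈ supportedOn P := fun _ hv => unit_of_ne fun hvw => hv (hvw ▸ h)

lemma supportedOn_mono {P Q : Finset (Fin m)} (h : P ⊆ Q) : supportedOn P ≤ supportedOn Q :=
  fun _ hx w hw => hx w fun hP => hw (h hP)

lemma sum_single_apply_of_ne {ι : Type*} [Fintype ι] (tgt : ι → Fin m) (t : ι → ZMod 2) (w : Fin m)
    (hw : ∀ i, w ≠ tgt i) : (∑ i, Pi.single (tgt i) (t i) : Bits m) w = 0 := by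
  rw [Finset.sum_apply]
  exact Finset.sum_eq_zero fun i _ => Pi.single_eq_of_ne (hw i) _

lemma sum_single_apply_self {ι : Type*} [Fintype ι] (tgt : ι → Fin m)
    (htgt : Function.Injective tgt) (t : ι → ZMod 2) (j : ι) :
    (∑ i, Pi.single (tgt i) (t i) : Bits m) (tgt j) = t j := by
  rw [Finset.sum_apply, Finset.sum_eq_single j]
  · simp
  · intro i _ hij; exact Pi.single_eq_of_ne (fun h => hij (htgt h).symm) _
  · intro h; exact absurd (Finset.mem_univ j) h

/-- The linear map of a family of `CX` gates none of whose controls is a target. -/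
def cxFamily {ι : Type*} [Fintype ι] (src tgt : ι → Fin m) (h : ∀ i j, src i ≠ tgt j) :
    Bits m ≃ₗ[ZMod 2] Bits m :=
  LinearEquiv.ofInvolutive
    (LinearMap.id + ∑ i, (LinearMap.single (ZMod 2) (fun _ => ZMod 2) (tgt i)) ∘ₗ
      LinearMap.proj (src i)) fun x => by
    simp only [LinearMap.add_apply, LinearMap.id_coe, id_eq, LinearMap.sum_apply,
      LinearMap.comp_apply, LinearMap.proj_apply, LinearMap.coe_single, Pi.add_apply]
    have h0 : ∀ i, (∑ j, (Pi.single (tgt j) (x (src j)) : Bits m)) (src i) = 0 := fun i =>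
      sum_single_apply_of_ne tgt (fun j => x (src j)) (src i) (h i)
    simp only [h0, add_zero]
    rw [add_assoc, bits_add_self, add_zero]

lemma cxFamily_apply {ι : Type*} [Fintype ι] (src tgt : ι → Fin m) (h : ∀ i j, src i ≠ tgt j)
    (x : Bits m) : cxFamily src tgt h x = x + ∑ i, Pi.single (tgt i) (x (src i)) := by
  simp [cxFamily, LinearEquiv.ofInvolutive]

lemma cxFamily_cxFamily {ι : Type*} [Fintype ι] (src tgt : ι → Fin m) (h : ∀ i j, src i ≠ tgt j)
    (x : Bits m) : cxFamily src tgt h (cxFamily src tgt h x) = x :=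
  (cxFamily src tgt h).left_inv x

lemma HasCircuit.map_add {W : Finset (Fin m)} {f : Bits m → Bits m} {s d c : ℕ}
    (h : HasCircuit W f s d c) (x y : Bits m) (hy : ∀ w ∈ W, y w = 0) : f (x + y) = f x + y := by
  obtain ⟨l, h, -⟩ := h
  exact h.map_add x y hy

lemma HasCircuit.map_of_vanish {W : Finset (Fin m)} {f : Bits m → Bits m} {s d c : ℕ}
    (h : HasCircuit W f s d c) (h0 : f 0 = 0) (y : Bits m) (hy : ∀ w ∈ W, y w = 0) : f y = y := by
  simpa [h0] using h.map_add 0 y hy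

lemma finrank_span_add_one_le (S : Finset (Bits m)) (h : 0 ∈ S) :
    Module.finrank (ZMod 2) (Submodule.span (ZMod 2) (S : Set (Bits m))) + 1 ≤ S.card := by
  have h1 : Submodule.span (ZMod 2) (S : Set (Bits m)) =
      Submodule.span (ZMod 2) ((S.erase 0 : Finset (Bits m)) : Set (Bits m)) := by
    rw [Finset.coe_erase, Submodule.span_sdiff_singleton_zero]
  rw [h1, ← Finset.card_erase_add_one h]
  exact Nat.add_le_add_right (finrank_span_finset_le_card _) 1

/-- Merging two blocks of wires. In one branch the flag `q` is off and the bits of the second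
block are zero; in the other branch the flag is on and the bits `y (src i)` are stored on the wires
`tgt i` of the second block. The circuit moves them back to the wires `src i`. -/
lemma hasCircuit_merge {c : ℕ} (W : Finset (Fin m)) (src tgt : Fin c → Fin m) (q : Fin m)
    (hs : ∀ i, src i ∈ W) (ht : ∀ i, tgt i ∈ W) (hq : q ∈ W) (hqs : ∀ i, q ≠ src i)
    (hqt : ∀ i, q ≠ tgt i) (hne : ∀ i j, src i ≠ tgt j) :
    ∃ g, HasCircuit W g (2 * c) (2 * c) c ∧
      (∀ x : Bits m, x q = 0 → (∀ i, x (tgt i) = 0) → g x = x) ∧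
      (∀ y : Bits m, y q = 0 → (∀ i, y (tgt i) = 0) →
        g (cxFamily tgt src (fun i j => (hne j i).symm) (cxFamily src tgt hne y) + unit q) =
          y + unit q) := by
  have h1 := hasCircuit_cx_family (W := W) Finset.univ tgt src (fun i _ => ht i) (fun i _ => hs i)
    (fun i _ j _ => (hne j i).symm)
  have h2 := hasCircuit_ccx_family (W := W) Finset.univ q src tgt hq (fun i _ => hs i)
    (fun i _ => ht i) (fun i _ => hqs i) (fun i _ => hqt i) (fun i _ j _ => hne i j)
  rw [Finset.card_univ, Fintype.card_fin] at h1 h2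
  refine ⟨_, (h1.comp h2).mono (Finset.Subset.refl _) (by omega) (by omega) (by omega), ?_, ?_⟩
  · intro x hxq hxt
    simp [hxq, hxt]
  · intro y hyq hyt
    simp only [← cxFamily_apply tgt src (fun i j => (hne j i).symm)]
    have hunit : cxFamily tgt src (fun i j => (hne j i).symm) (unit q) = unit q := by
      rw [cxFamily_apply]
      simp [(hqt _).symm]
    rw [_root_.map_add, cxFamily_cxFamily, hunit]
    have e1 : (cxFamily src tgt hne y + unit q) q = 1 := by
      rw [cxFamily_apply, Pi.add_apply, Pi.add_apply, hyq,
        sum_single_apply_of_ne tgt (fun i => y (src i)) q hqt, unit_self, zero_add, zero_add]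
    have e2 : ∀ i, (cxFamily src tgt hne y + unit q) (src i) = y (src i) := by
      intro i
      rw [cxFamily_apply, Pi.add_apply, Pi.add_apply,
        sum_single_apply_of_ne tgt (fun i => y (src i)) _ (hne i), unit_of_ne (hqs i).symm,
        add_zero, add_zero]
    simp only [e1, e2, one_mul]
    rw [cxFamily_apply, add_right_comm, add_assoc y, bits_add_self, add_zero]

/-- Every element of `S` is the image under `f` of `0` or of a one-hot string on the wires `W`. -/
def CoversFromOneHot (W : Finset (Fin m)) (f : Bits m → Bits m) (S : Finset (Bits m)) : Prop :=
  ∀ x ∈ S, ∃ h : Bits m, (h = 0 ∨ ∃ w ∈ W, h = unit w) ∧ f h = x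

/-- The recursive step: if the set `S` is cut in two by a linear functional, then circuits for the
two parts, taken in suitable coordinates and run in parallel on two blocks of wires, yield a
circuit for `S`. The number of `CCX` gates that merge the blocks is the dimension of the
intersection of the direction spaces of the two parts; hence the bound `c + rank + 1 ≤ #S`
is preserved. -/
lemma exists_oneHot_circuit_step {W : Finset (Fin m)} {S : Finset (Bits m)} (a : Bits m)
    (hW : W.card + 1 = S.card) (h0 : 0 ∈ S) (hSW : ∀ x ∈ S, x ∈ supportedOn W)
    (hne : (S.filter fun x => a ⬝ᵥ x = 1).Nonempty) (A d : ℕ)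
    (ih : ∀ (W' : Finset (Fin m)) (S' : Finset (Bits m)),
      (S'.card = (S.filter fun x => a ⬝ᵥ x = 0).card ∨
        S'.card = (S.filter fun x => a ⬝ᵥ x = 1).card) →
      W'.card + 1 = S'.card → 0 ∈ S' → (∀ x ∈ S', x ∈ supportedOn W') →
      ∃ f c, HasCircuit W' f (A * S'.card ^ 2) d c ∧ f 0 = 0 ∧ CoversFromOneHot W' f S' ∧
        c + Module.finrank (ZMod 2) (Submodule.span (ZMod 2) (S' : Set (Bits m))) + 1 ≤ S'.card) :
    ∃ f c, HasCircuit W f (A * (S.filter fun x => a ⬝ᵥ x = 0).card ^ 2 +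
        A * (S.filter fun x => a ⬝ᵥ x = 1).card ^ 2 + 4 * S.card ^ 2) (d + 7 * S.card) c ∧
      f 0 = 0 ∧ CoversFromOneHot W f S ∧
      c + Module.finrank (ZMod 2) (Submodule.span (ZMod 2) (S : Set (Bits m))) + 1 ≤ S.card := by
  classical
  set S₀ := S.filter fun x => a ⬝ᵥ x = 0 with hS₀
  set S₁ := S.filter fun x => a ⬝ᵥ x = 1 with hS₁
  have hcard : S₀.card + S₁.card = S.card := by
    have : S₁ = S.filter fun x => ¬ a ⬝ᵥ x = 0 := by
      refine Finset.filter_congr fun x _ => ?_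
      generalize a ⬝ᵥ x = t
      revert t; decide
    rw [this]; exact Finset.card_filter_add_card_filter_not _
  have h0S₀ : (0 : Bits m) ∈ S₀ := by simp [hS₀, h0]
  obtain ⟨p, hp⟩ := hne
  have hpS : p ∈ S := (Finset.mem_filter.mp hp).1
  have hpa : a ⬝ᵥ p = 1 := (Finset.mem_filter.mp hp).2
  set S₁' := S₁.image (· + p) with hS₁'
  have hS₁'card : S₁'.card = S₁.card := Finset.card_image_of_injective _ (add_left_injective p)
  have h0S₁' : (0 : Bits m) ∈ S₁' := Finset.mem_image.mpr ⟨p, hp, bits_add_self p⟩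
  set A₀ := Submodule.span (ZMod 2) (S₀ : Set (Bits m)) with hA₀
  set A₁ := Submodule.span (ZMod 2) (S₁' : Set (Bits m)) with hA₁
  have hr₀ := finrank_span_add_one_le S₀ h0S₀
  have hr₁ := finrank_span_add_one_le S₁' h0S₁'
  obtain ⟨c, k, l, u, v, w, hli, hs₀, hs₁, hf₀, hf₁⟩ := exists_adapted_family A₀ A₁
  rw [← hA₀, hf₀] at hr₀
  rw [← hA₁, hf₁, hS₁'card] at hr₁
  -- all the vectors of the family are in the kernel of the functional, and `p` is not
  have hA₀W : A₀ ≤ supportedOn W := Submodule.span_le.mpr fun x hx =>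
    hSW x (Finset.mem_filter.mp hx).1
  have hA₁W : A₁ ≤ supportedOn W := by
    refine Submodule.span_le.mpr fun x hx => ?_
    obtain ⟨y, hy, rfl⟩ := Finset.mem_image.mp hx
    exact add_mem (hSW y (Finset.mem_filter.mp hy).1) (hSW p hpS)
  let φ : Bits m →ₗ[ZMod 2] ZMod 2 := dotProductBilin (ZMod 2) (ZMod 2) a
  have hφ : ∀ x, φ x = a ⬝ᵥ x := fun x => rfl
  have hA₀φ : A₀ ≤ LinearMap.ker φ := Submodule.span_le.mpr fun x hx =>
    (Finset.mem_filter.mp hx).2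
  have hA₁φ : A₁ ≤ LinearMap.ker φ := by
    refine Submodule.span_le.mpr fun x hx => ?_
    obtain ⟨y, hy, rfl⟩ := Finset.mem_image.mp hx
    rw [SetLike.mem_coe, LinearMap.mem_ker, hφ, dotProduct_add, hpa,
      (Finset.mem_filter.mp hy).2]
    rfl
  have hu₀ : ∀ i, u i ∈ A₀ := fun i => hs₀ ▸ Submodule.mem_sup_left (Submodule.subset_span ⟨i, rfl⟩)
  have hv₀ : ∀ i, v i ∈ A₀ := fun i =>
    hs₀ ▸ Submodule.mem_sup_right (Submodule.subset_span ⟨i, rfl⟩)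
  have hw₁ : ∀ i, w i ∈ A₁ := fun i =>
    hs₁ ▸ Submodule.mem_sup_right (Submodule.subset_span ⟨i, rfl⟩)
  have hz : LinearIndependent (ZMod 2)
      (Sum.elim (Sum.elim (Sum.elim u v) w) (fun _ : Unit => p)) := by
    refine hli.sum_type (linearIndependent_unique_iff.mpr fun h => ?_) ?_
    · rw [show p = 0 from h] at hpa; simp at hpa
    · rw [Set.range_const, Submodule.disjoint_span_singleton']
      · intro hpm
        have hle : Submodule.span (ZMod 2) (Set.range (Sum.elim (Sum.elim u v) w)) ≤
            LinearMap.ker φ := by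
          rw [Submodule.span_le]
          rintro _ ⟨(i | i) | i, rfl⟩
          · exact hA₀φ (hu₀ i)
          · exact hA₀φ (hv₀ i)
          · exact hA₁φ (hw₁ i)
        have : a ⬝ᵥ p = 0 := hle hpm
        rw [hpa] at this; exact one_ne_zero this
      · rintro h; rw [h] at hpa; simp at hpa
  obtain ⟨π, Λ, hπ, hπW, hΛ, hΛc⟩ := exists_linear_circuit W _ hz (by
    rintro (((i | i) | i) | i)
    · exact hA₀W (hu₀ i)
    · exact hA₀W (hv₀ i)
    · exact hA₁W (hw₁ i)
    · exact hSW p hpS)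
  -- the wires of the two blocks
  set πu : Fin c → Fin m := fun i => π (.inl (.inl (.inl i))) with hπu
  set πv : Fin k → Fin m := fun i => π (.inl (.inl (.inr i))) with hπv
  set πw : Fin l → Fin m := fun i => π (.inl (.inr i)) with hπw
  set q : Fin m := π (.inr ()) with hq
  set P₀ := Finset.univ.image πu ∪ Finset.univ.image πv with hP₀
  set P₁ := Finset.univ.image πw with hP₁
  have hP₀card : P₀.card ≤ c + k := by
    refine (Finset.card_union_le _ _).trans (add_le_add ?_ ?_) <;>
      exact Finset.card_image_le.trans (by simp)
  have hP₁card : P₁.card ≤ l := Finset.card_image_le.trans (by simp)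
  have hP₀W : P₀ ⊆ W \ insert q P₁ := by
    intro x hx
    simp only [hP₀, hP₁, Finset.mem_union, Finset.mem_image, Finset.mem_univ, true_and,
      Finset.mem_sdiff, Finset.mem_insert, not_or, not_exists] at hx ⊢
    rcases hx with ⟨i, rfl⟩ | ⟨i, rfl⟩
    · exact ⟨hπW _, fun h => by simpa using hπ h, fun j h => by simpa using hπ h⟩
    · exact ⟨hπW _, fun h => by simpa using hπ h, fun j h => by simpa using hπ h⟩
  have hqP₁ : insert q P₁ ⊆ W := by
    intro x hx
    simp only [hP₁, Finset.mem_insert, Finset.mem_image, Finset.mem_univ, true_and] at hx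
    rcases hx with rfl | ⟨i, rfl⟩ <;> exact hπW _
  obtain ⟨W₀, hPW₀, hW₀, hW₀card⟩ := Finset.exists_subsuperset_card_eq hP₀W
    (n := S₀.card - 1) (by omega) (by
      rw [Finset.card_sdiff_of_subset hqP₁]
      have := Finset.card_insert_le q P₁
      omega)
  have hqW₀ : q ∉ W₀ := fun h => (Finset.mem_sdiff.mp (hW₀ h)).2 (Finset.mem_insert_self _ _)
  have hW₀W : W₀ ⊆ W := hW₀.trans Finset.sdiff_subset
  set W₁ := W \ insert q W₀ with hW₁
  have hW₁card : W₁.card + 1 = S₁.card := by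
    rw [hW₁, Finset.card_sdiff_of_subset (Finset.insert_subset (hπW _) hW₀W),
      Finset.card_insert_of_notMem hqW₀]
    omega
  have hdisj : Disjoint W₀ W₁ := by
    rw [Finset.disjoint_left]
    intro x hx hx'
    exact (Finset.mem_sdiff.mp hx').2 (Finset.mem_insert_of_mem hx)
  have hqW₁ : q ∉ W₁ := fun h => (Finset.mem_sdiff.mp h).2 (Finset.mem_insert_self _ _)
  have hW₁W : W₁ ⊆ W := Finset.sdiff_subset
  have hP₁W₁ : P₁ ⊆ W₁ := by
    intro x hx
    rw [hW₁, Finset.mem_sdiff, Finset.mem_insert, not_or]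
    refine ⟨hqP₁ (Finset.mem_insert_of_mem hx), ?_, fun h =>
      (Finset.mem_sdiff.mp (hW₀ h)).2 (Finset.mem_insert_of_mem hx)⟩
    rintro rfl
    simp only [hP₁, Finset.mem_image, Finset.mem_univ, true_and] at hx
    obtain ⟨i, hi⟩ := hx
    simpa using hπ hi
  -- room in the second block for a copy of the common coordinates
  obtain ⟨τ⟩ : Nonempty (Fin c ↪ (W₁ \ P₁ : Finset (Fin m))) := by
    refine Function.Embedding.nonempty_of_card_le ?_
    rw [Fintype.card_fin, Fintype.card_coe, Finset.card_sdiff_of_subset hP₁W₁]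
    omega
  set u' : Fin c → Fin m := fun i => (τ i : Fin m) with hu'
  have hu'W₁ : ∀ i, u' i ∈ W₁ := fun i => (Finset.mem_sdiff.mp (τ i).2).1
  have hu'P₁ : ∀ i, u' i ∉ P₁ := fun i => (Finset.mem_sdiff.mp (τ i).2).2
  have hπuW₀ : ∀ i, πu i ∈ W₀ := fun i => hPW₀ (by simp [hP₀])
  have hπinj : Function.Injective πu := fun i j h => by simpa using hπ h
  have hne' : ∀ i j, πu i ≠ u' j := fun i j h =>
    Finset.disjoint_left.mp hdisj (hπuW₀ i) (h ▸ hu'W₁ j)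
  obtain ⟨g, hg, hg₀, hg₁⟩ := hasCircuit_merge W πu u' q (fun i => hW₀W (hπuW₀ i))
    (fun i => hW₁W (hu'W₁ i)) (hπW _) (fun i h => hqW₀ (h ▸ hπuW₀ i))
    (fun i h => hqW₁ (h ▸ hu'W₁ i)) hne'
  set E₁ := cxFamily πu u' hne' with hE₁
  set E₂ := cxFamily u' πu (fun i j => (hne' j i).symm) with hE₂
  -- the two parts in the new coordinates
  have hΛu : ∀ i, Λ.symm (u i) = unit (πu i) := fun i =>
    (LinearEquiv.symm_apply_eq Λ).mpr (hΛ (.inl (.inl (.inl i)))).symm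
  have hΛv : ∀ i, Λ.symm (v i) = unit (πv i) := fun i =>
    (LinearEquiv.symm_apply_eq Λ).mpr (hΛ (.inl (.inl (.inr i)))).symm
  have hΛw : ∀ i, Λ.symm (w i) = unit (πw i) := fun i =>
    (LinearEquiv.symm_apply_eq Λ).mpr (hΛ (.inl (.inr i))).symm
  have hΛp : Λ (unit q) = p := hΛ (.inr ())
  have hA₀P : ∀ x ∈ A₀, Λ.symm x ∈ supportedOn P₀ := by
    intro x hx
    have : A₀ ≤ (supportedOn P₀).comap (Λ.symm : Bits m →ₗ[ZMod 2] Bits m) := by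
      rw [← hs₀]
      refine sup_le (Submodule.span_le.mpr ?_) (Submodule.span_le.mpr ?_)
      · rintro _ ⟨i, rfl⟩
        change Λ.symm (u i) ∈ supportedOn P₀
        rw [hΛu]; exact unit_mem_supportedOn (by simp [hP₀])
      · rintro _ ⟨i, rfl⟩
        change Λ.symm (v i) ∈ supportedOn P₀
        rw [hΛv]; exact unit_mem_supportedOn (by simp [hP₀])
    exact this hx
  have hA₁P : ∀ x ∈ A₁, Λ.symm x ∈ supportedOn (Finset.univ.image πu ∪ P₁) := by
    intro x hx
    have : A₁ ≤ (supportedOn (Finset.univ.image πu ∪ P₁)).comap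
        (Λ.symm : Bits m →ₗ[ZMod 2] Bits m) := by
      rw [← hs₁]
      refine sup_le (Submodule.span_le.mpr ?_) (Submodule.span_le.mpr ?_)
      · rintro _ ⟨i, rfl⟩
        change Λ.symm (u i) ∈ supportedOn _
        rw [hΛu]; exact unit_mem_supportedOn (by simp)
      · rintro _ ⟨i, rfl⟩
        change Λ.symm (w i) ∈ supportedOn _
        rw [hΛw]; exact unit_mem_supportedOn (by simp [hP₁])
    exact this hx
  have hy_u' : ∀ y ∈ supportedOn (Finset.univ.image πu ∪ P₁), ∀ i, y (u' i) = 0 := by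
    intro y hy i
    refine hy _ ?_
    simp only [Finset.mem_union, Finset.mem_image, Finset.mem_univ, true_and, not_or]
    exact ⟨fun ⟨j, hj⟩ => hne' j i hj, hu'P₁ i⟩
  have hy_q : ∀ y ∈ supportedOn (Finset.univ.image πu ∪ P₁), y q = 0 := by
    intro y hy
    refine hy _ ?_
    simp only [Finset.mem_union, Finset.mem_image, Finset.mem_univ, true_and, not_or]
    exact ⟨fun ⟨j, hj⟩ => hqW₀ (hj ▸ hπuW₀ j), fun h => hqW₁ (hP₁W₁ h)⟩
  have hEW₁ : ∀ y ∈ supportedOn (Finset.univ.image πu ∪ P₁), E₂ (E₁ y) ∈ supportedOn W₁ := by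
    intro y hy x hx
    have e1 : ∀ i, E₁ y (u' i) = y (πu i) := by
      intro i
      rw [hE₁, cxFamily_apply, Pi.add_apply, hy_u' y hy i, zero_add]
      exact sum_single_apply_self u' (fun i j h => τ.injective (Subtype.ext h))
        (fun i => y (πu i)) i
    have e2 : E₁ y x = y x := by
      rw [hE₁, cxFamily_apply, Pi.add_apply,
        sum_single_apply_of_ne u' (fun i => y (πu i)) x (fun i h => hx (h ▸ hu'W₁ i)), add_zero]
    rw [hE₂, cxFamily_apply, Pi.add_apply, e2]
    simp only [e1]
    by_cases hxu : ∃ i, πu i = x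
    · obtain ⟨i, rfl⟩ := hxu
      rw [sum_single_apply_self πu hπinj (fun i => y (πu i)) i]
      exact CharTwo.add_self_eq_zero _
    · rw [sum_single_apply_of_ne πu (fun i => y (πu i)) x (fun i h => hxu ⟨i, h.symm⟩), add_zero]
      refine hy x ?_
      simp only [Finset.mem_union, Finset.mem_image, Finset.mem_univ, true_and, not_or]
      exact ⟨hxu, fun h => hx (hP₁W₁ h)⟩
  let Θ : Bits m ≃ₗ[ZMod 2] Bits m := (Λ.symm.trans E₁).trans E₂
  have hΘ : ∀ x, Θ x = E₂ (E₁ (Λ.symm x)) := fun x => rfl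
  have hspan : ∀ (e : Bits m ≃ₗ[ZMod 2] Bits m) (T : Finset (Bits m)),
      Module.finrank (ZMod 2) (Submodule.span (ZMod 2) ((T.image e : Finset _) : Set (Bits m))) =
        Module.finrank (ZMod 2) (Submodule.span (ZMod 2) (T : Set (Bits m))) := by
    intro e T
    rw [Finset.coe_image]
    have := Submodule.span_image (e : Bits m →ₗ[ZMod 2] Bits m) (s := (T : Set (Bits m)))
    rw [show (e : Bits m → Bits m) '' T = (e : Bits m →ₗ[ZMod 2] Bits m) '' T from rfl, this]
    exact LinearEquiv.finrank_map_eq e _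
  have hT₀card : (S₀.image Λ.symm).card = S₀.card :=
    Finset.card_image_of_injective _ Λ.symm.injective
  have hT₁card : (S₁'.image Θ).card = S₁.card := by
    rw [Finset.card_image_of_injective _ Θ.injective, hS₁'card]
  obtain ⟨f₀, c₀, hf₀c, hf₀0, hf₀cov, hc₀⟩ := ih W₀ (S₀.image Λ.symm) (Or.inl hT₀card)
    (by have := Finset.card_pos.mpr ⟨_, h0S₀⟩; omega)
    (Finset.mem_image.mpr ⟨0, h0S₀, map_zero _⟩) (by
      intro x hx
      obtain ⟨y, hy, rfl⟩ := Finset.mem_image.mp hx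
      exact supportedOn_mono hPW₀ (hA₀P y (Submodule.subset_span hy)))
  obtain ⟨f₁, c₁, hf₁c, hf₁0, hf₁cov, hc₁⟩ := ih W₁ (S₁'.image Θ) (Or.inr hT₁card)
    (by omega)
    (Finset.mem_image.mpr ⟨0, h0S₁', map_zero _⟩) (by
      intro x hx
      obtain ⟨y, hy, rfl⟩ := Finset.mem_image.mp hx
      exact hEW₁ _ (hA₁P y (Submodule.subset_span hy)))
  rw [hT₀card] at hf₀c hc₀
  rw [hT₁card] at hf₁c hc₁
  rw [hspan, ← hA₀, hf₀] at hc₀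
  rw [hspan, ← hA₁, hf₁] at hc₁
  -- the flag is switched on for the one-hot strings of the second block
  have hF := hasCircuit_cx_family (W := W) W₁ (fun x => x) (fun _ => q) (fun i hi => hW₁W hi)
    (fun _ _ => hπW _) (fun i hi _ _ h => hqW₁ (h ▸ hi))
  set F : Bits m → Bits m := fun x => x + ∑ i ∈ W₁, Pi.single q (x i) with hFdef
  have hF0 : ∀ x : Bits m, (∀ i ∈ W₁, x i = 0) → F x = x := by
    intro x hx
    rw [hFdef]
    simp only
    rw [Finset.sum_eq_zero (fun i hi => by rw [hx i hi, Pi.single_zero]), add_zero]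
  have hF1 : ∀ i ∈ W₁, F (unit i) = unit i + unit q := by
    intro i hi
    rw [hFdef]
    simp only
    rw [Finset.sum_eq_single_of_mem i hi, unit_self]
    intro j _ hj
    rw [unit_of_ne hj, Pi.single_zero]
  have hpar := (hf₀c.par hdisj hf₁c).mono (Finset.union_subset hW₀W hW₁W) le_rfl le_rfl le_rfl
  have hcirc := ((hF.comp hpar).comp hg).comp hΛc
  have hq₀ : ∀ i ∈ W₀, (unit q : Bits m) i = 0 := fun i hi =>
    unit_of_ne fun h => hqW₀ (h ▸ hi)
  have hq₁ : ∀ i ∈ W₁, (unit q : Bits m) i = 0 := fun i hi =>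
    unit_of_ne fun h => hqW₁ (h ▸ hi)
  have hW₁₀ : ∀ i ∈ W₁, ∀ j ∈ W₀, (unit i : Bits m) j = 0 := fun i hi j hj =>
    unit_of_ne fun h => Finset.disjoint_left.mp hdisj hj (h ▸ hi)
  refine ⟨_, _, hcirc.mono (Finset.Subset.refl _) ?_ ?_ le_rfl, ?_, ?_, ?_⟩
  · simp only [Fintype.card_sum, Fintype.card_fin, Fintype.card_unit]
    have e1 : W₁.card ≤ S.card := by omega
    have e2 : 2 * c ≤ 2 * S.card := by omega
    have e3 : c + k + l + 1 ≤ S.card := by omega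
    have e4 : (c + k + l + 1) * W.card ≤ S.card * (S.card - 1) := Nat.mul_le_mul e3 (by omega)
    have e5 : 1 ≤ S.card := by omega
    obtain ⟨s, hs⟩ : ∃ s, S.card = s + 1 := ⟨S.card - 1, by omega⟩
    have e6 : 2 ≤ S.card := by
      have := Finset.card_pos.mpr ⟨_, h0S₀⟩
      have := Finset.card_pos.mpr ⟨_, hp⟩
      omega
    rw [hs] at e4 e1 e2 e6 ⊢
    rw [Nat.add_sub_cancel] at e4
    nlinarith
  · omega
  · rw [hF0 0 (fun _ _ => rfl), hf₀0, hf₁0, hg₀ 0 rfl (fun _ => rfl), _root_.map_zero]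
  · intro x hx
    by_cases hxa : a ⬝ᵥ x = 0
    · have hx₀ : x ∈ S₀ := Finset.mem_filter.mpr ⟨hx, hxa⟩
      obtain ⟨h, hh, hfh⟩ := hf₀cov (Λ.symm x) (Finset.mem_image_of_mem _ hx₀)
      have ht : Λ.symm x ∈ supportedOn W₀ :=
        supportedOn_mono hPW₀ (hA₀P x (Submodule.subset_span hx₀))
      have hh₁ : ∀ i ∈ W₁, h i = 0 := by
        intro i hi
        rcases hh with rfl | ⟨j, hj, rfl⟩
        · rfl
        · exact unit_of_ne fun h => Finset.disjoint_left.mp hdisj hj (h ▸ hi)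
      refine ⟨h, hh.imp_right fun ⟨j, hj, e⟩ => ⟨j, hW₀W hj, e⟩, ?_⟩
      simp only
      rw [hF0 h hh₁, hfh, hf₁c.map_of_vanish hf₁0 _
        (fun i hi => ht i (Finset.disjoint_right.mp hdisj hi)), hg₀ _ (ht q hqW₀)
        (fun i => ht _ (Finset.disjoint_right.mp hdisj (hu'W₁ i))), Λ.apply_symm_apply]
    · have hx₁ : x ∈ S₁ := by
        refine Finset.mem_filter.mpr ⟨hx, ?_⟩
        revert hxa
        generalize a ⬝ᵥ x = t
        revert t; decide
      have hxp : x + p ∈ S₁' := Finset.mem_image_of_mem _ hx₁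
      obtain ⟨h, hh, hfh⟩ := hf₁cov (Θ (x + p)) (Finset.mem_image_of_mem _ hxp)
      have hy := hA₁P _ (Submodule.subset_span hxp)
      obtain ⟨h', hh', hFh⟩ : ∃ h' : Bits m, (h' = 0 ∨ ∃ w ∈ W, h' = unit w) ∧
          F h' = h + unit q := by
        rcases hh with rfl | ⟨j, hj, rfl⟩
        · exact ⟨unit q, Or.inr ⟨q, hπW _, rfl⟩, by rw [hF0 _ hq₁, zero_add]⟩
        · exact ⟨unit j, Or.inr ⟨j, hW₁W hj, rfl⟩, hF1 j hj⟩
      have hh₀ : ∀ i ∈ W₀, (h + unit q) i = 0 := by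
        intro i hi
        rw [Pi.add_apply, hq₀ i hi, add_zero]
        rcases hh with rfl | ⟨j, hj, rfl⟩
        · rfl
        · exact hW₁₀ j hj i hi
      refine ⟨h', hh', ?_⟩
      simp only
      rw [hFh, hf₀c.map_of_vanish hf₀0 _ hh₀, hf₁c.map_add h (unit q) hq₁, hfh, hΘ,
        hg₁ _ (hy_q _ hy) (hy_u' _ hy), _root_.map_add, Λ.apply_symm_apply, hΛp, add_assoc,
        bits_add_self, add_zero]
  · have hrank : Module.finrank (ZMod 2) (Submodule.span (ZMod 2) (S : Set (Bits m))) ≤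
        c + k + l + 1 := by
      have hle : Submodule.span (ZMod 2) (S : Set (Bits m)) ≤ Submodule.span (ZMod 2)
          (Set.range (Sum.elim (Sum.elim (Sum.elim u v) w) (fun _ : Unit => p))) := by
        set Z := Submodule.span (ZMod 2)
          (Set.range (Sum.elim (Sum.elim (Sum.elim u v) w) (fun _ : Unit => p))) with hZ
        have hZ₀ : A₀ ≤ Z := by
          rw [← hs₀]
          refine sup_le (Submodule.span_mono ?_) (Submodule.span_mono ?_)
          · rintro _ ⟨i, rfl⟩; exact ⟨.inl (.inl (.inl i)), rfl⟩
          · rintro _ ⟨i, rfl⟩; exact ⟨.inl (.inl (.inr i)), rfl⟩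
        have hZ₁ : A₁ ≤ Z := by
          rw [← hs₁]
          refine sup_le (Submodule.span_mono ?_) (Submodule.span_mono ?_)
          · rintro _ ⟨i, rfl⟩; exact ⟨.inl (.inl (.inl i)), rfl⟩
          · rintro _ ⟨i, rfl⟩; exact ⟨.inl (.inr i), rfl⟩
        have hZp : p ∈ Z := Submodule.subset_span ⟨.inr (), rfl⟩
        rw [Submodule.span_le]
        intro x hx
        by_cases hxa : a ⬝ᵥ x = 0
        · exact hZ₀ (Submodule.subset_span (Finset.mem_filter.mpr ⟨hx, hxa⟩))
        · have hx₁ : x ∈ S₁ := by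
            refine Finset.mem_filter.mpr ⟨hx, ?_⟩
            revert hxa
            generalize a ⬝ᵥ x = t
            revert t; decide
          have := add_mem (hZ₁ (Submodule.subset_span (Finset.mem_image_of_mem _ hx₁))) hZp
          rwa [add_assoc, bits_add_self, add_zero] at this
      refine (Submodule.finrank_mono hle).trans ((finrank_range_le_card _).trans ?_)
      simp
    omega

/-- For every set `S ∋ 0` of `|W| + 1` bit strings on the wires `W` there is a reversible circuit
on these wires, without ancillas, that maps the one-hot strings onto the nonzero elements of `S`.
Its depth is linear, because the two halves of a balanced cut are treated in parallel. The constants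
solve the recurrences of the recursive step for parts of size `p, q ≤ 3/4 #S`: then
`p ^ 2 + q ^ 2 ≤ 5/8 #S ^ 2`, so `16 * 5/8 + 4 ≤ 16`, and `28 * 3/4 + 7 = 28`. -/
theorem exists_oneHot_circuit (W : Finset (Fin m)) (S : Finset (Bits m))
    (hW : W.card + 1 = S.card) (h0 : 0 ∈ S) (hSW : ∀ x ∈ S, x ∈ supportedOn W) :
    ∃ f c, HasCircuit W f (16 * S.card ^ 2) (28 * S.card) c ∧ f 0 = 0 ∧
      CoversFromOneHot W f S ∧
      c + Module.finrank (ZMod 2) (Submodule.span (ZMod 2) (S : Set (Bits m))) + 1 ≤ S.card := by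
  induction hs : S.card using Nat.strong_induction_on generalizing W S with
  | _ s ih =>
    subst hs
    by_cases h2 : 2 ≤ S.card
    · obtain ⟨a, ha₀, ha₁⟩ := exists_balanced S h2
      have hcard : (S.filter fun x => a ⬝ᵥ x = 0).card + (S.filter fun x => a ⬝ᵥ x = 1).card =
          S.card := by
        have : (S.filter fun x => a ⬝ᵥ x = 1) = S.filter fun x => ¬ a ⬝ᵥ x = 0 := by
          refine Finset.filter_congr fun x _ => ?_
          generalize a ⬝ᵥ x = t
          revert t; decide
        rw [this]; exact Finset.card_filter_add_card_filter_not _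
      have hne : (S.filter fun x => a ⬝ᵥ x = 1).Nonempty := by
        rw [← Finset.card_pos]; omega
      obtain ⟨f, c, h1, h2', h3, h4⟩ := exists_oneHot_circuit_step a hW h0 hSW hne 16
        (21 * S.card) (fun W' S' hS' hW' h0' hSW' => by
          have hlt : 4 * S'.card ≤ 3 * S.card := by rcases hS' with h | h <;> omega
          obtain ⟨f, c, h1, h2, h3, h4⟩ := ih S'.card (by omega) W' S' hW' h0' hSW' rfl
          exact ⟨f, c, h1.mono (Finset.Subset.refl _) le_rfl (by omega) le_rfl, h2, h3, h4⟩)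
      refine ⟨f, c, h1.mono (Finset.Subset.refl _) ?_ (by omega) le_rfl, h2', h3, h4⟩
      rw [← hcard] at ha₀ ha₁ ⊢
      generalize (S.filter fun x => a ⬝ᵥ x = 0).card = p at *
      generalize (S.filter fun x => a ⬝ᵥ x = 1).card = q at *
      zify at ha₀ ha₁ ⊢
      nlinarith [mul_nonneg (sub_nonneg.mpr ha₀) (sub_nonneg.mpr ha₁)]
    · have hS1 : S.card = 1 := by omega
      have hS : S = {0} := by
        obtain ⟨x, hx⟩ := Finset.card_eq_one.mp hS1
        rw [hx] at h0 ⊢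
        rw [Finset.mem_singleton.mp h0]
      refine ⟨fun x => x, 0, (hasCircuit_id W).mono (Finset.Subset.refl _) (by omega) (by omega)
        le_rfl, rfl, ?_, ?_⟩
      · intro x hx
        rw [hS, Finset.mem_singleton] at hx
        exact ⟨0, Or.inl rfl, hx.symm⟩
      · rw [hS]; simp

/-! ### Preparation of one-hot superpositions -/

/-- Polar coordinates of `(x, y)`, with the polar angle written as `θ / 2`. -/
lemma exists_half_angle (x y : ℝ) : ∃ θ : ℝ,
    √(x ^ 2 + y ^ 2) * Real.cos (θ / 2) = x ∧ √(x ^ 2 + y ^ 2) * Real.sin (θ / 2) = y := by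
  refine ⟨2 * Complex.arg ⟨x, y⟩, ?_⟩
  have h : √(x ^ 2 + y ^ 2) = ‖(⟨x, y⟩ : ℂ)‖ := by
    rw [Complex.norm_eq_sqrt_sq_add_sq]
  rw [h, mul_div_cancel_left₀ _ (two_ne_zero), Complex.norm_mul_cos_arg, Complex.norm_mul_sin_arg]
  exact ⟨rfl, rfl⟩

/-- A ladder of controlled rotations along a list of wires turns the one-hot string on the first
wire into a superposition of the one-hot strings, with prescribed amplitudes. Scaling the input by
the norm `ρ` of the amplitudes avoids any division. Strings that vanish on the list are fixed. -/
lemma exists_ladder (α : Fin m → ℂ) (qs : List (Fin m)) (p : Fin m) (hnd : (p :: qs).Nodup) :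
    ∃ l : List (PlacedGate m), l.length ≤ 3 * (p :: qs).length ∧
      l.countP (fun g => g.gate.nonClifford) ≤ 2 * (p :: qs).length ∧
      (∀ x : Bits m, (∀ w ∈ p :: qs, x w = 0) → runList l (cket x) = cket x) ∧
      runList l (((√((p :: qs).map fun w => ‖α w‖ ^ 2).sum : ℝ) : ℂ) • cket (unit p)) =
        ((p :: qs).map fun w => α w • cket (unit w)).sum := by
  induction qs generalizing p with
  | nil =>
    refine ⟨[gP (Complex.arg (α p)) p], by simp, by simp [gP, Gate.nonClifford], ?_, ?_⟩
    · intro x hx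
      rw [runList_singleton, apply_gP, hx p (by simp), if_neg zero_ne_one, one_smul]
    · rw [map_smul, runList_singleton, apply_gP, unit_self, if_pos rfl, smul_smul]
      simp only [List.map_cons, List.map_nil, List.sum_cons, List.sum_nil, add_zero]
      rw [Real.sqrt_sq (norm_nonneg _), Complex.norm_mul_exp_arg_mul_I]
  | cons q qs ih =>
    obtain ⟨hp, hnd'⟩ := List.nodup_cons.mp hnd
    obtain ⟨l, hl1, hl2, hl3, hl4⟩ := ih q hnd'
    have hpq : p ≠ q := fun h => hp (by simp [h])
    set σ := ((q :: qs).map fun w => ‖α w‖ ^ 2).sum with hσ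
    have hσ0 : 0 ≤ σ := List.sum_nonneg fun y hy => by
      obtain ⟨w, -, rfl⟩ := List.mem_map.mp hy
      positivity
    obtain ⟨θ, hc, hs⟩ := exists_half_angle ‖α p‖ √σ
    refine ⟨[gCRY θ p q hpq, gCX q p hpq.symm, gP (Complex.arg (α p)) p] ++ l, ?_, ?_, ?_, ?_⟩
    · simp only [List.length_append, List.length_cons, List.length_nil] at hl1 ⊢
      omega
    · rw [List.countP_append]
      simp only [List.countP_cons, List.countP_nil, gCRY, gCX, gP, Gate.nonClifford,
        List.length_cons] at hl2 ⊢
      simp only [if_true, Bool.false_eq_true, if_false]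
      omega
    · intro x hx
      rw [runList_append, runList_cons, runList_cons, runList_singleton,
        apply_gCRY_of_eq_zero _ _ _ _ _ (hx p (by simp)), apply_gCX, hx q (by simp),
        Pi.single_zero, add_zero, apply_gP, hx p (by simp), if_neg zero_ne_one, one_smul]
      exact hl3 x fun w hw => hx w (by simp [List.mem_cons.mp hw])
    · have hsum : ((p :: q :: qs).map fun w => ‖α w‖ ^ 2).sum = ‖α p‖ ^ 2 + √σ ^ 2 := by
        rw [List.map_cons, List.sum_cons, Real.sq_sqrt hσ0]
      rw [hsum]
      set ρ := √(‖α p‖ ^ 2 + √σ ^ 2) with hρ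
      have h1 : runList [gCRY θ p q hpq, gCX q p hpq.symm, gP (Complex.arg (α p)) p]
          ((ρ : ℂ) • cket (unit p)) = α p • cket (unit p) + (√σ : ℂ) • cket (unit q) := by
        rw [map_smul, runList_cons, runList_cons, runList_singleton,
          apply_gCRY_of_eq_one _ _ _ _ _ (unit_self p) (unit_of_ne hpq.symm)]
        simp only [map_add, map_smul, apply_gCX]
        have e1 : (unit p + Pi.single p ((unit p : Bits m) q) : Bits m) = unit p := by
          rw [unit_of_ne hpq.symm, Pi.single_zero, add_zero]
        have e2 : (unit p + unit q + Pi.single p ((unit p + unit q : Bits m) q) : Bits m) =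
            unit q := by
          rw [Pi.add_apply, unit_of_ne hpq.symm, unit_self, zero_add, add_right_comm,
            bits_add_self, zero_add]
        rw [e1, e2, apply_gP, apply_gP, unit_self, unit_of_ne hpq, if_pos rfl,
          if_neg zero_ne_one, one_smul, smul_add, smul_smul, smul_smul, smul_smul]
        congr 2
        · rw [← Complex.ofReal_mul, hc, Complex.norm_mul_exp_arg_mul_I]
        · rw [← Complex.ofReal_mul, hs]
      rw [runList_append, h1, map_add, hl4, map_smul, hl3 (unit p) fun w hw =>
        unit_of_ne fun h => hp (h ▸ hw)]
      simp only [List.map_cons, List.sum_cons]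

lemma finish_le_length (l : List (PlacedGate m)) (e : Fin m → ℕ) (k : ℕ) (he : ∀ w, e w ≤ k)
    (w : Fin m) : finish l e w ≤ k + l.length := by
  induction l generalizing e k with
  | nil => simpa using he w
  | cons g l ih =>
    rw [finish_cons, List.length_cons]
    refine (ih (g.advance e) (k + 1) fun v => ?_).trans (by omega)
    unfold PlacedGate.advance
    split_ifs
    · exact Nat.add_le_add_right (Finset.sup_le fun v _ => he v) 1
    · exact (he v).trans (Nat.le_succ k)

/-! ### Sparse states -/

/-- A set of `s ≤ m` bit strings on `m` wires is the image of the one-hot strings on some `s` wires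
under a reversible circuit. -/
theorem exists_oneHot_circuit_univ (T : Finset (Bits m)) (hT : T.Nonempty) (hTm : T.card ≤ m) :
    ∃ (V : Finset (Fin m)) (Φ : Bits m → Bits m), V.card = T.card ∧
      HasCircuit Finset.univ Φ (21 * (T.card * m)) (35 * m) T.card ∧
      ∀ t ∈ T, ∃ w ∈ V, Φ (unit w) = t := by
  classical
  obtain ⟨p, hp⟩ := hT
  set T' := T.image (· + p) with hT'
  have hT'card : T'.card = T.card := Finset.card_image_of_injective _ (add_left_injective p)
  have h0T' : (0 : Bits m) ∈ T' := Finset.mem_image.mpr ⟨p, hp, bits_add_self p⟩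
  set A := Submodule.span (ZMod 2) (T' : Set (Bits m)) with hA
  have hr := finrank_span_add_one_le T' h0T'
  obtain ⟨r, k, _, u, v, _, hli, hs, -, hf, -⟩ := exists_adapted_family A A
  have huv : LinearIndependent (ZMod 2) (Sum.elim u v) := hli.comp Sum.inl Sum.inl_injective
  rw [← hA, hf, hT'card] at hr
  obtain ⟨π, Λ, hπ, -, hΛ, hΛc⟩ := exists_linear_circuit Finset.univ _ huv
    (fun _ w hw => absurd (Finset.mem_univ w) hw)
  obtain ⟨W, hPW, -, hWcard⟩ := Finset.exists_subsuperset_card_eq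
    (Finset.subset_univ (Finset.univ.image π)) (n := T.card - 1)
    (Finset.card_image_le.trans (by simp; omega)) (by simp; omega)
  obtain ⟨a, ha⟩ : ∃ a, a ∉ W := by
    by_contra hcon
    push Not at hcon
    rw [Finset.eq_univ_iff_forall.mpr hcon, Finset.card_univ, Fintype.card_fin] at hWcard
    omega
  have hAW : ∀ x ∈ A, Λ.symm x ∈ supportedOn W := by
    intro x hx
    have : A ≤ (supportedOn W).comap (Λ.symm : Bits m →ₗ[ZMod 2] Bits m) := by
      rw [← hs, ← Submodule.span_union, ← Set.Sum.elim_range, Submodule.span_le]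
      rintro _ ⟨i, rfl⟩
      change Λ.symm (Sum.elim u v i) ∈ supportedOn W
      rw [(LinearEquiv.symm_apply_eq Λ).mpr (hΛ i).symm]
      exact unit_mem_supportedOn (hPW (by simp))
    exact this hx
  have hRcard : (T'.image Λ.symm).card = T.card := by
    rw [Finset.card_image_of_injective _ Λ.symm.injective, hT'card]
  obtain ⟨f, c, hfc, hf0, hfcov, hc⟩ := exists_oneHot_circuit W (T'.image Λ.symm) (by omega)
    (Finset.mem_image.mpr ⟨0, h0T', map_zero _⟩) (by
      intro x hx
      obtain ⟨y, hy, rfl⟩ := Finset.mem_image.mp hx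
      exact hAW y (Submodule.subset_span hy))
  rw [hRcard] at hfc hc
  -- the wire `a`, hot for the base point only, is cleared first
  have h1 := hasCircuit_cx_family (W := Finset.univ) W (fun i => i) (fun _ => a)
    (fun _ _ => Finset.mem_univ _) (fun _ _ => Finset.mem_univ _)
    (fun i hi _ _ h => ha (h ▸ hi))
  have h2 := hasCircuit_gX (Finset.mem_univ a)
  have h3 := hasCircuit_add_sum_unit (W := Finset.univ) (Finset.univ.filter fun i => p i = 1)
    (Finset.subset_univ _)
  have hpsum : ∑ i ∈ Finset.univ.filter (fun i => p i = 1), unit i = p := by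
    rw [Finset.sum_filter]
    ext j
    rw [Finset.sum_apply, Finset.sum_eq_single j]
    · split_ifs with h
      · rw [unit_self, h]
      · exact (eq_zero_of_ne_one _ h).symm
    · intro i _ hij
      split_ifs
      · exact unit_of_ne hij.symm
      · rfl
    · intro h; exact absurd (Finset.mem_univ j) h
  rw [hpsum] at h3
  have hI : (Finset.univ.filter fun i => p i = 1).card ≤ m :=
    (Finset.card_le_univ _).trans (by simp)
  have hcirc := (((h1.comp h2).comp (hfc.mono (Finset.subset_univ _) le_rfl le_rfl le_rfl)).comp
    hΛc).comp h3
  have hpos : 1 ≤ T.card := Finset.card_pos.mpr ⟨p, hp⟩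
  refine ⟨insert a W, _, by rw [Finset.card_insert_of_notMem ha]; omega,
    hcirc.mono (Finset.Subset.refl _) ?_ ?_ (by omega), ?_⟩
  · rw [Finset.card_univ, Fintype.card_fin, Fintype.card_sum, Fintype.card_fin, Fintype.card_fin]
    have e1 : T.card ^ 2 ≤ T.card * m := by rw [sq]; exact Nat.mul_le_mul_left _ hTm
    have e2 : (r + k) * m ≤ T.card * m := Nat.mul_le_mul_right _ (by omega)
    have e3 : m ≤ T.card * m := Nat.le_mul_of_pos_left m hpos
    omega
  · rw [Finset.card_univ, Fintype.card_fin]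
    omega
  · intro t ht
    have htp : t + p ∈ T' := Finset.mem_image_of_mem _ ht
    obtain ⟨h, hh, hfh⟩ := hfcov (Λ.symm (t + p)) (Finset.mem_image_of_mem _ htp)
    have key : Λ (f h) + p = t := by
      rw [hfh, Λ.apply_symm_apply, add_assoc, bits_add_self, add_zero]
    rcases hh with rfl | ⟨w, hw, rfl⟩
    · refine ⟨a, Finset.mem_insert_self _ _, ?_⟩
      rw [Finset.sum_eq_zero (fun i hi => by
        rw [unit_of_ne (fun h' : i = a => ha (h' ▸ hi)), Pi.single_zero]), add_zero, bits_add_self]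
      exact key
    · refine ⟨w, Finset.mem_insert_of_mem hw, ?_⟩
      rw [Finset.sum_eq_single_of_mem w hw (fun i _ hi => by
        rw [unit_of_ne hi, Pi.single_zero]), unit_self, add_assoc, bits_add_self, add_zero]
      exact key

/-- The bit string `x` followed by zeros. -/
def padZero {n : ℕ} (a : ℕ) (x : Fin n → Fin 2) : Bits (n + a) :=
  Fin.append (α := Fin 2) x 0

lemma padZero_castAdd {n : ℕ} (a : ℕ) (x : Fin n → Fin 2) (i : Fin n) :
    padZero a x (Fin.castAdd a i) = x i := Fin.append_left (α := Fin 2) x 0 i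

lemma padZero_injective {n : ℕ} (a : ℕ) : Function.Injective (padZero (n := n) a) := by
  intro x y h
  funext i
  have := congrFun h (Fin.castAdd a i)
  rwa [padZero_castAdd, padZero_castAdd] at this

lemma ket_apply {n : ℕ} (x y : Fin n → Fin 2) : ket x y = if y = x then 1 else 0 := by
  simp only [ket, PiLp.single_apply]

lemma tensor_sum_ket {n a : ℕ} (S : Finset (Fin n → Fin 2)) (α : (Fin n → Fin 2) → ℂ) :
    tensor (∑ x ∈ S, α x • ket x) (ketZero a) = ∑ x ∈ S, α x • cket (padZero a x) := by
  ext y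
  have h : ∀ x : Fin n → Fin 2, (cket (padZero a x)) y =
      ket x (fun i => y (Fin.castAdd a i)) * ketZero a (fun j => y (Fin.natAdd n j)) := by
    intro x
    rw [ketZero, ket_apply, ket_apply]
    refine (ket_apply (n := n + a) (padZero a x) y).trans ?_
    have : y = padZero a x ↔ (fun i => y (Fin.castAdd a i)) = x ∧
        (fun j => y (Fin.natAdd n j)) = 0 := by
      constructor
      · rintro rfl
        exact ⟨funext fun i => padZero_castAdd a x i,
          funext fun j => Fin.append_right (α := Fin 2) x 0 j⟩
      · rintro ⟨h1, h2⟩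
        funext i
        refine Fin.addCases (fun i => ?_) (fun j => ?_) i
        · rw [padZero_castAdd]; exact congrFun h1 i
        · exact (congrFun h2 j).trans (Fin.append_right (α := Fin 2) x 0 j).symm
    by_cases hy : y = padZero a x
    · rw [if_pos (this.mp hy).1, if_pos (this.mp hy).2, one_mul]
      exact if_pos hy
    · refine (if_neg hy).trans ?_
      rw [ite_zero_mul_ite_zero, if_neg fun h => hy (this.mpr h)]
  simp only [tensor, PiLp.toLp_apply, WithLp.ofLp_sum, Finset.sum_apply,
    WithLp.ofLp_smul, Pi.smul_apply, h, Finset.sum_mul, smul_eq_mul, mul_assoc]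

lemma norm_sq_sum_ket {n : ℕ} (S : Finset (Fin n → Fin 2)) (α : (Fin n → Fin 2) → ℂ) :
    ‖(∑ x ∈ S, α x • ket x : Qubits n)‖ ^ 2 = ∑ x ∈ S, ‖α x‖ ^ 2 := by
  rw [EuclideanSpace.norm_sq_eq]
  have : ∀ y, (∑ x ∈ S, α x • ket x : Qubits n) y = if y ∈ S then α y else 0 := by
    intro y
    simp only [WithLp.ofLp_sum, Finset.sum_apply, WithLp.ofLp_smul, Pi.smul_apply, ket_apply,
      smul_eq_mul, mul_ite, mul_one, mul_zero]
    rw [Finset.sum_ite_eq]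
  simp only [this]
  rw [← Finset.sum_filter_add_sum_filter_not Finset.univ (· ∈ S)]
  simp only [Finset.filter_univ_mem]
  rw [Finset.sum_congr rfl (g := fun x => ‖α x‖ ^ 2) fun x hx => by rw [if_pos hx],
    Finset.sum_eq_zero (s := Finset.univ.filter (· ∉ S)) fun x hx => by
      rw [if_neg (Finset.mem_filter.mp hx).2, norm_zero, zero_pow two_ne_zero], add_zero]

end SparsePrep

theorem mainTheorem1 :
    ∃ K : ℕ, ∀ (s n : ℕ) (ψ : SparsePrep.Qubits n), SparsePrep.IsSparse s ψ →
      ∃ C : SparsePrep.Circuit (n + (max s n - n)),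
        C.Prepares ψ ∧
        C.size ≤ K * (s * max s n) ∧
        C.depth ≤ K * max s n ∧
        C.nonCliffordCount ≤ K * s := by
  open SparsePrep in
  classical
  -- size at most `4 s + 21 s m`, depth at most `4 s + 35 m`, at most `3 s` non-Clifford gates
  refine ⟨50, fun s n ψ hψ => ?_⟩
  obtain ⟨hnorm, S, α, hS, rfl⟩ := hψ
  have hm : n + (max s n - n) = max s n := by omega
  generalize max s n - n = b at hm ⊢
  have hsm : s ≤ n + b := by omega
  rw [← hm]
  have hs0 : 1 ≤ s := by
    by_contra h
    have : S = ∅ := Finset.card_eq_zero.mp (by omega)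
    rw [this] at hnorm
    simp at hnorm
  have hα : ∑ x ∈ S, ‖α x‖ ^ 2 = 1 := by rw [← norm_sq_sum_ket, hnorm, one_pow]
  set T := S.image (padZero b) with hT
  have hTcard : T.card = s := by
    rw [hT, Finset.card_image_of_injective _ (padZero_injective b), hS]
  obtain ⟨V, Φ, hV, ⟨l₂, hl₂, hb₂⟩, hcov⟩ := exists_oneHot_circuit_univ T
    (Finset.card_pos.mp (by omega)) (by omega)
  rw [hTcard] at hV hb₂
  -- the circuit is a bijection from the one-hot strings on `V` to `T`
  have himage : V.image (fun w => Φ (unit w)) = T := by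
    refine (Finset.eq_of_subset_of_card_le (fun t ht => ?_) ?_).symm
    · obtain ⟨w, hw, h⟩ := hcov t ht
      exact Finset.mem_image.mpr ⟨w, hw, h⟩
    · exact Finset.card_image_le.trans (by omega)
  have hinj : Set.InjOn (fun w => Φ (unit w)) (V : Set (Fin (n + b))) := by
    rw [← Finset.card_image_iff, himage, hTcard, hV]
  set β : Bits (n + b) → ℂ := fun y => α fun i => y (Fin.castAdd b i) with hβ
  have hβα : ∀ x, β (padZero b x) = α x := fun x =>
    congrArg α (funext fun i => padZero_castAdd b x i)
  have htransfer : ∀ {M : Type} [AddCommMonoid M] (F : Bits (n + b) → M),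
      ∑ w ∈ V, F (Φ (unit w)) = ∑ x ∈ S, F (padZero b x) := by
    intro M _ F
    rw [← Finset.sum_image (f := F) hinj, himage, hT,
      Finset.sum_image fun x _ y _ h => padZero_injective b h]
  obtain ⟨p, hp⟩ : V.Nonempty := Finset.card_pos.mp (by omega)
  have hnd : (p :: (V.erase p).toList).Nodup :=
    List.nodup_cons.mpr ⟨by simp, Finset.nodup_toList _⟩
  have hset : (p :: (V.erase p).toList).toFinset = V := by
    rw [List.toFinset_cons, Finset.toList_toFinset, Finset.insert_erase hp]
  have hlen : (p :: (V.erase p).toList).length = s := by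
    rw [← List.toFinset_card_of_nodup hnd, hset, hV]
  obtain ⟨l₁, hl₁, hc₁, -, hr₁⟩ := exists_ladder (fun w => β (Φ (unit w))) _ p hnd
  rw [hlen] at hl₁ hc₁
  rw [← List.sum_toFinset _ hnd, ← List.sum_toFinset _ hnd, hset,
    htransfer (fun y => ‖β y‖ ^ 2)] at hr₁
  simp only [hβα, hα, Real.sqrt_one, Complex.ofReal_one, one_smul] at hr₁
  have hrun : runList ([gX p] ++ l₁ ++ l₂) (ketZero (n + b)) =
      tensor (∑ x ∈ S, α x • ket x) (ketZero b) := by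
    have h0 : ketZero (n + b) = cket (0 : Bits (n + b)) := rfl
    rw [runList_append, runList_append, runList_singleton, h0, apply_gX, zero_add, hr₁, map_sum,
      tensor_sum_ket]
    simp only [map_smul, hl₂.run]
    rw [htransfer (fun y => β y • cket y)]
    simp only [hβα]
  have hlen₁ : ([gX p] ++ l₁).length ≤ 4 * s := by
    rw [List.length_append, List.length_singleton]; omega
  obtain ⟨C, hC1, hC2, hC3⟩ := exists_circuit_of_finish_le ([gX p] ++ l₁ ++ l₂)
    (4 * s + 35 * (n + b)) (fun w => by
      rw [finish_append]
      exact hb₂.finish_le _ (4 * s) (fun v _ =>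
        (finish_le_length _ 0 0 (fun _ => le_rfl) v).trans (by omega)) w (Finset.mem_univ w))
  refine ⟨C, (hC3 _).trans hrun, ?_, ?_, ?_⟩
  · rw [Circuit.size, hC2.length_eq, List.length_append]
    have := hb₂.length_le
    have e : s ≤ s * (n + b) := Nat.le_mul_of_pos_right s (by omega)
    omega
  · rw [hC1]; omega
  · rw [Circuit.nonCliffordCount, hC2.countP_eq, List.countP_append, List.countP_append]
    have := hb₂.count_le
    have e : [gX p].countP (fun g => g.gate.nonClifford) = 0 := by simp [gX, Gate.nonClifford]
    omega

end
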